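/- Let $\mathbb{R}^5_1$ be $\mathbb{R}^5$ with $\langle x,y\rangle=\sum_{i=1}^4x^iy^i-x^5y^5$ and flat connection $\hat\nabla$, and let $\mathbb{H}^4=\{x\in\mathbb{R}^5_1:\langle x,x\rangle=-1,\ x^5>0\}$. Let $\varphi:M^2\to\mathbb{H}^4$ be a smooth immersion of a connected oriented surface, endowed with the induced metric, and let $\Phi:M\to\mathbb{R}^5_1$ be its composition with the inclusion. Let $B$ be the second fundamental form of $\varphi$, $H=\tfrac12\operatorname{trace}B$ its mean curvature vector field and $f=|H|$. Assume that $\varphi$ is a (non-CMC) PNMC biconservative immersion, i.e. - $f>0$ and $\operatorname{grad}f\neq0$ at every point of $M$; - $H/|H|$ is parallel in the normal bundle of $\varphi$: $\nabla^\perp(H/|H|)=0$; - no nonempty open subset of $M$ is mapped into a totally geodesic hypersurface $\mathbb{H}^3\subset\mathbb{H}^4$; - the tangential part of the bitension field $\tau_2(\varphi)=-\Delta^\varphi\tau(\varphi)-\operatorname{trace}R^{\mathbb{H}^4}(\varphi_*,\tau(\varphi))\varphi_*$ vanishes, where $\tau(\varphi)=2H$, $\Delta^\varphi=-\operatorname{trace}(\nabla^\varphi\nabla^\varphi-\nabla^\varphi_\nabla)$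 and $R(X,Y)Z=[\nabla_X,\nabla_Y]Z-\nabla_{[X,Y]}Z$. Let $E_1=\operatorname{grad}f/|\operatorname{grad}f|$, and let $E_2$ be the smooth unit vector field on $M$ such that $\{E_1,E_2\}$ is a positively oriented orthonormal frame field. Put $\xi=\hat\nabla_{E_2}E_2$ (where $E_2$ is regarded as the $\mathbb{R}^5_1$-valued map $\Phi_*E_2$), and assume that $\xi$ is a nonzero null vector field: $\xi\neq0$ and $\langle\xi,\xi\rangle=0$ at every point of $M$. Let $\gamma:J\to M$ be an integral curve of $E_2$ on an open interval $J\ni0$, and $\hat\gamma=\Phi\circ\gamma$. Then: (i) $\hat\gamma$ is a smooth unit speed curve with $\hat\gamma''=\xi\circ\gamma$, and its curvature $\hat\kappa=\sqrt{|\langle\hat\gamma'',\hat\gamma''\rangle|}$ is zero; (ii) $\xi$ is constant along $\hat\gamma$; (iii) for all $v\in J$, $$\hat\gamma(v)=\overline B_0+v\,\overline B_1+\tfrac12v^2\,\overline B_2,$$ where $\overline B_0=\hat\gamma(0)$, $\overline B_1=E_2(\gamma(0))$, $\overline B_2=\xi(\gamma(0))$, and $$\langle\overline B_1,\overline B_1\rangle=1,\qquad\langle\overline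 B_2,\overline B_2\rangle=\langle\overline B_1,\overline B_2\rangle=0.$$ In particular, the curve $v\mapsto\overline B_0+v\overline B_1+\tfrac12v^2\overline B_2$, $v\in\mathbb{R}$, is a parabola (the image of $y=x^2$ under an injective affine map), and $\hat\gamma$ is contained in it and in the affine plane $\overline B_0+\operatorname{span}\{\overline B_1,\overline B_2\}$, which is two-dimensional and lightlike (the form $\langle\cdot,\cdot\rangle$ is degenerate on its direction). -/

import Mathlib

open scoped Manifold ContDiff

noncomputable section

namespace PNMC

/-! ### The Minkowski space `ℝ⁵₁` and the hyperboloid model of `ℍ⁴` -/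

/-- The vector space `ℝ⁵` underlying the Minkowski space `ℝ⁵₁`. Only its vector space structure
and topology are used; the metric is the Lorentzian one given by `mink`. -/
abbrev R51 : Type := EuclideanSpace ℝ (Fin 5)

/-- The Minkowski product `x¹y¹ + x²y² + x³y³ + x⁴y⁴ - x⁵y⁵`. -/
def mink (x y : R51) : ℝ :=
  x 0 * y 0 + x 1 * y 1 + x 2 * y 2 + x 3 * y 3 - x 4 * y 4

/-- `ℍ⁴`, the upper sheet of the hyperboloid. -/
def hyperboloid : Set R51 := {q | mink q q = -1 ∧ 0 < q 4}

/-- For `q ∈ ℍ⁴`, the orthogonal projection of `ℝ⁵₁` onto `T_q ℍ⁴ = q^⊥`. -/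
def projH (q w : R51) : R51 := w + mink w q • q

/-- The Levi-Civita connection of `ℍ⁴`: tangential part of the derivative in `ℝ⁵₁`, for vector
fields on `ℝ⁵` that are tangent to `ℍ⁴` along `ℍ⁴`. -/
def connH (X Y : R51 → R51) (q : R51) : R51 := projH q (fderiv ℝ Y q (X q))

/-- The curvature tensor `R(x, y)z` of `ℍ⁴` at `q ∈ ℍ⁴`, for `x, y, z ∈ T_q ℍ⁴`, with the sign
convention `R(X, Y)Z = ∇_X ∇_Y Z - ∇_Y ∇_X Z - ∇_{[X, Y]} Z`. It is evaluated on the vector fields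
`q' ↦ projH q' x`, etc., which are tangent to `ℍ⁴` and extend `x`, `y`, `z`. -/
def curvH (q x y z : R51) : R51 :=
  let X : R51 → R51 := fun q' => projH q' x
  let Y : R51 → R51 := fun q' => projH q' y
  let Z : R51 → R51 := fun q' => projH q' z
  connH X (connH Y Z) q - connH Y (connH X Z) q - connH (VectorField.lieBracket ℝ X Y) Z q

/-! ### Submanifold geometry of an immersed surface

Below, `Φ : M → ℝ⁵₁` is a smooth immersion of a surface `M` with image in `ℍ⁴`, that is, the
composition of an immersion `φ : M → ℍ⁴` with the inclusion, and `M` carries the induced metric.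
Sections of `φ⁻¹(Tℍ⁴)` are treated as maps `V : M → ℝ⁵` with `V p ∈ T_{Φ p} ℍ⁴`. -/

section Surface

variable {M : Type*} [TopologicalSpace M] [ChartedSpace (EuclideanSpace ℝ (Fin 2)) M]

/-- Tangent vectors of the surface. -/
abbrev TS (p : M) : Type := TangentSpace (𝓡 2) p

/-- Directional derivative of a vector valued function on `M`. For `F : M → ℝ⁵` this is the
flat connection `∇̂_x F` of `ℝ⁵₁`. -/
def dd {E : Type*} [NormedAddCommGroup E] [NormedSpace ℝ E] (F : M → E) (p : M) (x : TS p) : E :=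
  mvfderiv (𝓡 2) F p x

/-- The induced metric `g = Φ^*⟨·,·⟩`. -/
def met (Φ : M → R51) (p : M) (x y : TS p) : ℝ := mink (dd Φ p x) (dd Φ p y)

/-- A basis of `T_p M` (its choice does not matter). -/
def bas (p : M) (i : Fin 2) : TS p := (EuclideanSpace.single i (1 : ℝ) : EuclideanSpace ℝ (Fin 2))

/-- The coefficients `g^{ij}` of the inverse of the matrix of the induced metric. -/
def invMet (Φ : M → R51) (p : M) : Matrix (Fin 2) (Fin 2) ℝ :=
  (Matrix.of fun i j => met Φ p (bas p i) (bas p j))⁻¹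

/-- The tangent vector dual to a linear form `α` on `T_p M`: `g(sharp α, x) = α x`. -/
def sharp (Φ : M → R51) (p : M) (α : TS p → ℝ) : TS p :=
  ∑ i, ∑ j, (invMet Φ p i j * α (bas p i)) • bas p j

/-- The trace with respect to the induced metric of a vector valued bilinear form on `T_p M`. -/
def tr (Φ : M → R51) (p : M) (β : TS p → TS p → R51) : R51 :=
  ∑ i, ∑ j, invMet Φ p i j • β (bas p i) (bas p j)

/-- The tangent vector of `M` whose image is the orthogonal projection of `w` onto the tangent
plane `dΦ(T_p M)`. -/
def tan (Φ : M → R51) (p : M) (w : R51) : TS p := sharp Φ p fun x => mink w (dd Φ p x)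

/-- The component of `w` orthogonal to the tangent plane `dΦ(T_p M)`. -/
def nor (Φ : M → R51) (p : M) (w : R51) : R51 := w - dd Φ p (tan Φ p w)

/-- Gradient of a function on `M`. -/
def grad (Φ : M → R51) (u : M → ℝ) (p : M) : TS p := sharp Φ p fun x => dd u p x

/-- The vector field `X` on `M`, seen as the `ℝ⁵`-valued map `Φ_* X`. -/
def push (Φ : M → R51) (X : (p : M) → TS p) (p : M) : R51 := dd Φ p (X p)

/-- An extension of `y ∈ T_p M` to a smooth vector field on `M`, used to evaluate tensors: at `q`,
project the constant vector `dΦ_p y` onto the tangent plane at `q`. -/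
def ext (Φ : M → R51) (p : M) (y : TS p) (q : M) : TS q := tan Φ q (dd Φ p y)

/-- The Levi-Civita connection of the induced metric: tangential part of the derivative. -/
def nablaM (Φ : M → R51) (p : M) (x : TS p) (Y : (q : M) → TS q) : TS p :=
  tan Φ p (dd (push Φ Y) p x)

/-- The connection `∇^φ` induced on `φ⁻¹(Tℍ⁴)` by the Levi-Civita connection of `ℍ⁴`. -/
def nablaPhi (Φ : M → R51) (p : M) (x : TS p) (V : M → R51) : R51 := projH (Φ p) (dd V p x)

/-- The normal connection `∇^⊥` of `φ : M → ℍ⁴`, for sections `η` of the normal bundle of `φ`. -/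
def nablaPerp (Φ : M → R51) (p : M) (x : TS p) (η : M → R51) : R51 := nor Φ p (nablaPhi Φ p x η)

/-- The second fundamental form `B` of `φ : M → ℍ⁴`. -/
def sff (Φ : M → R51) (p : M) (x y : TS p) : R51 :=
  nor Φ p (nablaPhi Φ p x (push Φ (ext Φ p y)))

/-- The mean curvature vector field `H = (trace B) / 2` of `φ : M → ℍ⁴`. -/
def meanCurv (Φ : M → R51) (p : M) : R51 := (1 / 2 : ℝ) • tr Φ p (sff Φ p)

/-- The mean curvature function `f = |H|`. -/
def meanFun (Φ : M → R51) (p : M) : ℝ := Real.sqrt (mink (meanCurv Φ p) (meanCurv Φ p))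

/-- The tension field `τ(φ) = 2H`. -/
def tension (Φ : M → R51) (p : M) : R51 := (2 : ℝ) • meanCurv Φ p

/-- The rough Laplacian `Δ^φ V = - trace (∇^φ ∇^φ - ∇^φ_∇) V`. -/
def roughLap (Φ : M → R51) (V : M → R51) (p : M) : R51 :=
  -tr Φ p fun x y =>
    nablaPhi Φ p x (fun q => nablaPhi Φ q (ext Φ p y q) V) -
      nablaPhi Φ p (nablaM Φ p x (ext Φ p y)) V

/-- The bitension field `τ₂(φ) = - Δ^φ τ(φ) - trace R(φ_*, τ(φ)) φ_*`. -/
def bitension (Φ : M → R51) (p : M) : R51 :=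
  -roughLap Φ (tension Φ) p -
    tr Φ p fun x y => curvH (Φ p) (dd Φ p x) (tension Φ p) (dd Φ p y)

/-- Smooth vector fields on `M`. -/
def SmoothField [IsManifold (𝓡 2) ∞ M] (X : (p : M) → TS p) : Prop :=
  ContMDiff (𝓡 2) (𝓡 2).tangent ∞ fun p => (⟨p, X p⟩ : TangentBundle (𝓡 2) M)

/-- `Φ = ι ∘ φ`, where `φ : M → ℍ⁴` is a non-CMC, PNMC biconservative immersion: `f > 0`,
`grad f` is nowhere zero, `∇^⊥ (H / |H|) = 0`, no nonempty open subset of `M` is mapped into a totally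
geodesic hypersurface `ℍ³ = ℍ⁴ ∩ n^⊥`, and the tangent part of the bitension field vanishes. -/
structure IsPNMCBiconservative (Φ : M → R51) : Prop where
  smooth : ContMDiff (𝓡 2) 𝓘(ℝ, R51) ∞ Φ
  mem_hyperboloid : ∀ p, Φ p ∈ hyperboloid
  immersion : ∀ p, Function.Injective (dd Φ p)
  meanFun_pos : ∀ p, 0 < meanFun Φ p
  grad_ne_zero : ∀ p, grad Φ (meanFun Φ) p ≠ 0
  parallel : ∀ p (x : TS p),
    nablaPerp Φ p x (fun q => (1 / meanFun Φ q) • meanCurv Φ q) = 0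
  full : ∀ U : Set M, IsOpen U → U.Nonempty →
    ∀ n : R51, 0 < mink n n → ¬ ∀ p ∈ U, mink (Φ p) n = 0
  biconservative : ∀ p, tan Φ p (bitension Φ p) = 0

/-- `(E₁, E₂)` is the orthonormal frame field of `M` with `E₁ = grad f / |grad f|`; the sign of
`E₂` corresponds to the choice of the orientation of `M`. -/
structure IsAdaptedFrame [IsManifold (𝓡 2) ∞ M] (Φ : M → R51) (E₁ E₂ : (p : M) → TS p) :
    Prop where
  smooth_fst : SmoothField E₁
  smooth_snd : SmoothField E₂
  fst_eq : ∀ p, E₁ p =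
    (1 / Real.sqrt (met Φ p (grad Φ (meanFun Φ) p) (grad Φ (meanFun Φ) p))) •
      grad Φ (meanFun Φ) p
  orthogonal : ∀ p, met Φ p (E₁ p) (E₂ p) = 0
  unit_snd : ∀ p, met Φ p (E₂ p) (E₂ p) = 1

/-- The `ℝ⁵₁`-valued vector field `∇̂_X X` along the surface. -/
def accel (Φ : M → R51) (X : (p : M) → TS p) (p : M) : R51 := dd (push Φ X) p (X p)

end Surface

/-! ### Curves and planes in `ℝ⁵₁` -/

/-- The curvature `√|⟨c'', c''⟩|` of a unit speed curve in `ℝ⁵₁`. -/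
def curveCurvature (c : ℝ → R51) (t : ℝ) : ℝ :=
  Real.sqrt |mink (deriv (deriv c) t) (deriv (deriv c) t)|

/-- Parabolas in `ℝ⁵`: the images of `y = x²` under injective affine maps. -/
def IsParabola (S : Set R51) : Prop :=
  ∃ A : (ℝ × ℝ) →ᵃ[ℝ] R51, Function.Injective A ∧ S = A '' {z | z.2 = z.1 ^ 2}

/-- Lightlike affine planes: the Minkowski product is degenerate on the direction. -/
def IsLightlikePlane (P : AffineSubspace ℝ R51) : Prop :=
  (P : Set R51).Nonempty ∧ Module.finrank ℝ P.direction = 2 ∧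
    ∃ w ∈ P.direction, w ≠ 0 ∧ ∀ u ∈ P.direction, mink w u = 0

end PNMC

end

/-! Put n = H/|H| and ω = ⟨∇̂_{E₂}E₂, E₁⟩, and let A = -dn be the shape operator of n. Because n is
parallel in the normal bundle, dn has tangent values. The Codazzi equations for n and trace A = 2f
turn biconservativity into A(grad f) = -f grad f (`shape_grad`). Hence the frame is principal:
dn(E₁) = f E₁, dn(E₂) = -3f E₂, with E₂f = 0.

The rest comes from one identity (`commutator`): for a vector-valued F, E₁E₂F - E₂E₁F = dF([E₁,
E₂]), which expresses the flatness of ℝ⁵₁. Taking F = n and F = Φ gives ∇̂_{E₁}E₂ = 0 and 4fω =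
3E₁f; F = f then gives E₂ω = 0; F = Φ_*E₁ shows that ∇̂_{E₂}∇̂_{E₁}E₁ is a multiple of E₂.

Differentiating ∇̂_{E₁}E₁ + ξ = 2f n + 2Φ + ωE₁ along E₂ now yields ∇̂_{E₂}ξ = μE₂. Since ⟨ξ, E₂⟩ =
0, μ = -⟨ξ, ξ⟩ = 0 (`dd_accel_snd`). So the curve has constant acceleration and is quadratic. Its
initial velocity is a unit vector orthogonal to the nonzero null vector ξ, which makes the two
independent and puts ξ in the radical of the plane they span. -/

open Filter Topology

noncomputable section

namespace PNMC

/-! ### Differential calculus of vector-valued maps on the surface -/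

section Calculus

variable {M : Type*} [TopologicalSpace M] [ChartedSpace (EuclideanSpace ℝ (Fin 2)) M]
variable {E : Type*} [NormedAddCommGroup E] [NormedSpace ℝ E]

lemma dd_add_right (F : M → E) (p : M) (x y : TS p) : dd F p (x + y) = dd F p x + dd F p y :=
  map_add (mvfderiv (𝓡 2) F p) x y

lemma dd_smul_right (F : M → E) (p : M) (c : ℝ) (x : TS p) : dd F p (c • x) = c • dd F p x :=
  map_smul (mvfderiv (𝓡 2) F p) c x

lemma dd_zero_right (F : M → E) (p : M) : dd F p 0 = 0 :=
  map_zero (mvfderiv (𝓡 2) F p)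

lemma dd_const (c : E) (p : M) (x : TS p) : dd (fun _ : M => c) p x = 0 := by
  simp [dd, mvfderiv_const]

lemma dd_add {F G : M → E} {p : M} (hF : MDifferentiableAt (𝓡 2) 𝓘(ℝ, E) F p)
    (hG : MDifferentiableAt (𝓡 2) 𝓘(ℝ, E) G p) (x : TS p) :
    dd (fun q => F q + G q) p x = dd F p x + dd G p x := by
  simp [dd, mvfderiv_fun_add hF hG]

lemma dd_sub {F G : M → E} {p : M} (hF : MDifferentiableAt (𝓡 2) 𝓘(ℝ, E) F p)
    (hG : MDifferentiableAt (𝓡 2) 𝓘(ℝ, E) G p) (x : TS p) :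
    dd (fun q => F q - G q) p x = dd F p x - dd G p x := by
  simp [dd, mvfderiv_fun_sub hF hG]

lemma dd_neg {F : M → E} {p : M} (x : TS p) :
    dd (fun q => -F q) p x = -dd F p x := by
  simp [dd, mvfderiv_fun_neg]

lemma dd_smul {u : M → ℝ} {F : M → E} {p : M} (hu : MDifferentiableAt (𝓡 2) 𝓘(ℝ, ℝ) u p)
    (hF : MDifferentiableAt (𝓡 2) 𝓘(ℝ, E) F p) (x : TS p) :
    dd (fun q => u q • F q) p x = dd u p x • F p + u p • dd F p x := by
  simp [dd, mvfderiv_fun_smul hu hF, add_comm]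

lemma dd_mul {u v : M → ℝ} {p : M} (hu : MDifferentiableAt (𝓡 2) 𝓘(ℝ, ℝ) u p)
    (hv : MDifferentiableAt (𝓡 2) 𝓘(ℝ, ℝ) v p) (x : TS p) :
    dd (fun q => u q * v q) p x = dd u p x * v p + u p * dd v p x :=
  dd_smul hu hv x

lemma dd_clm {E' : Type*} [NormedAddCommGroup E'] [NormedSpace ℝ E'] (L : E →L[ℝ] E')
    {F : M → E} {p : M} (hF : MDifferentiableAt (𝓡 2) 𝓘(ℝ, E) F p) (x : TS p) :
    dd (fun q => L (F q)) p x = L (dd F p x) := by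
  have h := mfderiv_comp_apply p (I := 𝓡 2) (I' := 𝓘(ℝ, E)) (I'' := 𝓘(ℝ, E'))
    (g := fun y => L y) (f := F) L.differentiableAt.mdifferentiableAt hF x
  have h2 : mfderiv 𝓘(ℝ, E) 𝓘(ℝ, E') (fun y => L y) (F p) = L := by
    rw [mfderiv_eq_fderiv]; exact L.fderiv
  refine Eq.trans h ?_
  rw [h2]; rfl

/-- Smooth maps from the surface to a normed space. -/
abbrev SmoothMap (F : M → E) : Prop := ContMDiff (𝓡 2) 𝓘(ℝ, E) ∞ F

lemma SmoothMap.mdiff {F : M → E} (hF : SmoothMap F) (p : M) :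
    MDifferentiableAt (𝓡 2) 𝓘(ℝ, E) F p :=
  (hF p).mdifferentiableAt (by simp)

lemma SmoothMap.fun_add {F G : M → E} (hF : SmoothMap F) (hG : SmoothMap G) :
    SmoothMap fun q => F q + G q := ContMDiff.add hF hG

lemma SmoothMap.fun_sub {F G : M → E} (hF : SmoothMap F) (hG : SmoothMap G) :
    SmoothMap fun q => F q - G q := ContMDiff.sub hF hG

lemma SmoothMap.fun_neg {F : M → E} (hF : SmoothMap F) :
    SmoothMap fun q => -F q := ContMDiff.neg hF

lemma SmoothMap.fun_smul {u : M → ℝ} {F : M → E} (hu : SmoothMap u) (hF : SmoothMap F) :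
    SmoothMap fun q => u q • F q := ContMDiff.smul hu hF

lemma smoothMap_const (c : E) : SmoothMap fun _ : M => c := contMDiff_const

variable [IsManifold (𝓡 2) ∞ M]

/-- The derivative of a smooth map along a smooth vector field is smooth. -/
lemma SmoothField.smooth_dd {X : (p : M) → TS p} (hX : SmoothField X) {F : M → E}
    (hF : SmoothMap F) : SmoothMap fun p => dd F p (X p) := by
  have h1 : ContMDiff (𝓡 2).tangent 𝓘(ℝ, E).tangent ∞ (tangentMap (𝓡 2) 𝓘(ℝ, E) F) :=
    ContMDiff.contMDiff_tangentMap hF (by simp)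
  exact (contMDiff_snd_tangentBundle_modelSpace E 𝓘(ℝ, E)).comp (h1.comp hX)

/-- In a chart, the derivative along a vector field is the derivative along its pullback. -/
lemma fderiv_comp_extChartAt_symm (X : (p : M) → TS p) {F : M → E} (hF : SmoothMap F) (p : M)
    {y : EuclideanSpace ℝ (Fin 2)} (hy : y ∈ (extChartAt (𝓡 2) p).target) :
    fderiv ℝ (F ∘ (extChartAt (𝓡 2) p).symm) y
      (VectorField.mpullbackWithin 𝓘(ℝ, EuclideanSpace ℝ (Fin 2)) (𝓡 2)
        (extChartAt (𝓡 2) p).symm X (Set.range (𝓡 2)) y) =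
      dd F ((extChartAt (𝓡 2) p).symm y) (X ((extChartAt (𝓡 2) p).symm y)) := by
  have hinv := isInvertible_mfderivWithin_extChartAt_symm (I := 𝓡 2) hy
  have hsymm : MDifferentiableAt 𝓘(ℝ, EuclideanSpace ℝ (Fin 2)) (𝓡 2)
      (extChartAt (𝓡 2) p).symm y :=
    ((contMDiffOn_extChartAt_symm (n := ∞) p).contMDiffAt
      ((isOpen_extChartAt_target p).mem_nhds hy)).mdifferentiableAt (by simp)
  have h := mfderiv_comp y (hF.mdiff ((extChartAt (𝓡 2) p).symm y)) hsymm
  rw [mfderiv_eq_fderiv] at h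
  rw [h, VectorField.mpullbackWithin_apply]
  simp only [modelWithCornersSelf_coe, Set.range_id, mfderivWithin_univ] at hinv ⊢
  exact congrArg (mfderiv (𝓡 2) 𝓘(ℝ, E) F ((extChartAt (𝓡 2) p).symm y))
    (hinv.self_apply_inverse _)

lemma SmoothMap.contDiffAt_comp_extChartAt_symm {F : M → E} (hF : SmoothMap F) (p : M) :
    ContDiffAt ℝ ∞ (F ∘ (extChartAt (𝓡 2) p).symm) (extChartAt (𝓡 2) p p) := by
  have h := (contMDiffOn_extChartAt_symm (I := 𝓡 2) (n := ∞) p).contMDiffAt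
    ((isOpen_extChartAt_target p).mem_nhds (mem_extChartAt_target (I := 𝓡 2) p))
  exact (ContMDiffAt.comp _ (hF _) h).contDiffAt

/-- Second derivatives along vector fields, in a chart. -/
lemma fderiv_fderiv_comp_extChartAt_symm {X Y : (p : M) → TS p}
    (hX : SmoothField X) {F : M → E} (hF : SmoothMap F) (p : M) :
    fderiv ℝ (fun y => fderiv ℝ (F ∘ (extChartAt (𝓡 2) p).symm) y
      (VectorField.mpullbackWithin 𝓘(ℝ, EuclideanSpace ℝ (Fin 2)) (𝓡 2)
        (extChartAt (𝓡 2) p).symm X (Set.range (𝓡 2)) y)) (extChartAt (𝓡 2) p p)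
      (VectorField.mpullbackWithin 𝓘(ℝ, EuclideanSpace ℝ (Fin 2)) (𝓡 2)
        (extChartAt (𝓡 2) p).symm Y (Set.range (𝓡 2)) (extChartAt (𝓡 2) p p)) =
      dd (fun q => dd F q (X q)) p (Y p) := by
  have h : (fun y => fderiv ℝ (F ∘ (extChartAt (𝓡 2) p).symm) y
      (VectorField.mpullbackWithin 𝓘(ℝ, EuclideanSpace ℝ (Fin 2)) (𝓡 2)
        (extChartAt (𝓡 2) p).symm X (Set.range (𝓡 2)) y)) =ᶠ[𝓝 (extChartAt (𝓡 2) p p)]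
      (fun q => dd F q (X q)) ∘ (extChartAt (𝓡 2) p).symm := by
    filter_upwards [(isOpen_extChartAt_target p).mem_nhds
      (mem_extChartAt_target (I := 𝓡 2) p)] with y hy
    exact fderiv_comp_extChartAt_symm X hF p hy
  rw [h.fderiv_eq, fderiv_comp_extChartAt_symm Y (hX.smooth_dd hF) p (mem_extChartAt_target p),
    extChartAt_to_inv]

lemma exists_fderiv_comp_extChartAt_symm_eq (p : M) (v : EuclideanSpace ℝ (Fin 2)) :
    ∃ Z : TS p, ∀ {E : Type} [NormedAddCommGroup E] [NormedSpace ℝ E] (F : M → E), SmoothMap F →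
      fderiv ℝ (F ∘ (extChartAt (𝓡 2) p).symm) (extChartAt (𝓡 2) p p) v = dd F p Z := by
  let w : EuclideanSpace ℝ (Fin 2) := mfderivWithin 𝓘(ℝ, EuclideanSpace ℝ (Fin 2)) (𝓡 2)
    (extChartAt (𝓡 2) p).symm (Set.range (𝓡 2)) (extChartAt (𝓡 2) p p) v
  refine ⟨w, fun {E} _ _ F hF => ?_⟩
  -- Every `TS q` is the model space, so the single vector `w` also defines a vector field; its
  -- pullback to the chart takes the value `v` at the base point.
  have h := fderiv_comp_extChartAt_symm (fun q => (w : TS q)) hF p (mem_extChartAt_target p)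
  rw [extChartAt_to_inv] at h
  rw [← h]
  exact congrArg _ ((isInvertible_mfderivWithin_extChartAt_symm (I := 𝓡 2)
    (mem_extChartAt_target p)).inverse_apply_self v).symm

/-- The commutator of the derivatives along two smooth vector fields is, at each point, the
derivative in the direction of a tangent vector. -/
lemma SmoothField.exists_commutator {X Y : (p : M) → TS p} (hX : SmoothField X)
    (hY : SmoothField Y) (p : M) :
    ∃ Z : TS p, ∀ {E : Type} [NormedAddCommGroup E] [NormedSpace ℝ E] (F : M → E),
      SmoothMap F →
      dd (fun q => dd F q (Y q)) p (X p) - dd (fun q => dd F q (X q)) p (Y p) = dd F p Z := by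
  have key : ∀ {W : (p : M) → TS p}, SmoothField W → DifferentiableAt ℝ
      (VectorField.mpullbackWithin 𝓘(ℝ, EuclideanSpace ℝ (Fin 2)) (𝓡 2)
        (extChartAt (𝓡 2) p).symm W (Set.range (𝓡 2))) (extChartAt (𝓡 2) p p) := by
    intro W hW
    have := MDifferentiableWithinAt.differentiableWithinAt_mpullbackWithin_vectorField
      (((hW p).mdifferentiableAt (by simp)).mdifferentiableWithinAt (s := Set.univ))
    rw [Set.preimage_univ, Set.univ_inter] at this
    exact this.differentiableAt (by simp)
  obtain ⟨Z, hZ⟩ := exists_fderiv_comp_extChartAt_symm_eq p (VectorField.lieBracket ℝ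
    (VectorField.mpullbackWithin 𝓘(ℝ, EuclideanSpace ℝ (Fin 2)) (𝓡 2)
      (extChartAt (𝓡 2) p).symm X (Set.range (𝓡 2)))
    (VectorField.mpullbackWithin 𝓘(ℝ, EuclideanSpace ℝ (Fin 2)) (𝓡 2)
      (extChartAt (𝓡 2) p).symm Y (Set.range (𝓡 2))) (extChartAt (𝓡 2) p p))
  refine ⟨Z, fun {E} _ _ F hF => ?_⟩
  rw [← fderiv_fderiv_comp_extChartAt_symm hX hF p, ← fderiv_fderiv_comp_extChartAt_symm hY hF p,
    ← hZ F hF]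
  -- Symmetry of the second derivative in the chart. The vector `Z` was built from the bracket
  -- alone, so it serves every `F`.
  exact (VectorField.fderiv_apply_lieBracket (n := 2)
      ((hF.contDiffAt_comp_extChartAt_symm p).of_le (WithTop.coe_le_coe.2 le_top))
      minSmoothness_of_isRCLikeNormedField.le
      (key hY) (key hX)).symm

end Calculus

/-! ### Algebra of the Minkowski product -/

section Minkowski

lemma mink_comm (x y : R51) : mink x y = mink y x := by simp only [mink]; ring

lemma mink_add_left (x y z : R51) : mink (x + y) z = mink x z + mink y z := by
  simp only [mink, PiLp.add_apply]; ring

lemma mink_smul_left (c : ℝ) (x z : R51) : mink (c • x) z = c * mink x z := by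
  simp only [mink, PiLp.smul_apply, smul_eq_mul]; ring

lemma mink_neg_left (x z : R51) : mink (-x) z = -mink x z := by
  simp only [mink, PiLp.neg_apply]; ring

lemma mink_sub_left (x y z : R51) : mink (x - y) z = mink x z - mink y z := by
  simp only [mink, PiLp.sub_apply]; ring

lemma mink_zero_left (z : R51) : mink 0 z = 0 := by simp [mink]

lemma mink_add_right (x y z : R51) : mink z (x + y) = mink z x + mink z y := by
  simp only [mink, PiLp.add_apply]; ring

lemma mink_smul_right (c : ℝ) (x z : R51) : mink z (c • x) = c * mink z x := by
  simp only [mink, PiLp.smul_apply, smul_eq_mul]; ring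

lemma mink_sub_right (x y z : R51) : mink z (x - y) = mink z x - mink z y := by
  simp only [mink, PiLp.sub_apply]; ring

lemma mink_zero_right (z : R51) : mink z 0 = 0 := by simp [mink]

/-- Vectors tangent to the hyperboloid are spacelike, with a quantitative bound. -/
lemma sum_sq_le_of_mink_eq_zero {q w : R51} (hq : q ∈ hyperboloid) (hw : mink w q = 0) :
    w 0 ^ 2 + w 1 ^ 2 + w 2 ^ 2 + w 3 ^ 2 ≤ mink w w * q 4 ^ 2 := by
  obtain ⟨h1, -⟩ := hq
  simp only [mink] at h1 hw ⊢
  have hcs : (w 0 * q 0 + w 1 * q 1 + w 2 * q 2 + w 3 * q 3) ^ 2 ≤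
      (w 0 ^ 2 + w 1 ^ 2 + w 2 ^ 2 + w 3 ^ 2) * (q 0 ^ 2 + q 1 ^ 2 + q 2 ^ 2 + q 3 ^ 2) := by
    nlinarith [sq_nonneg (w 0 * q 1 - w 1 * q 0), sq_nonneg (w 0 * q 2 - w 2 * q 0),
      sq_nonneg (w 0 * q 3 - w 3 * q 0), sq_nonneg (w 1 * q 2 - w 2 * q 1),
      sq_nonneg (w 1 * q 3 - w 3 * q 1), sq_nonneg (w 2 * q 3 - w 3 * q 2)]
  -- With S the sum of the four squares, Cauchy–Schwarz becomes (w₄q₄)² ≤ S(q₄² - 1), that is S ≤ (S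
  -- - w₄²)q₄².
  have e1 : w 0 * q 0 + w 1 * q 1 + w 2 * q 2 + w 3 * q 3 = w 4 * q 4 := by linarith
  have e2 : q 0 ^ 2 + q 1 ^ 2 + q 2 ^ 2 + q 3 ^ 2 = q 4 ^ 2 - 1 := by linarith
  rw [e1, e2] at hcs
  nlinarith [hcs]

/-- The bound kills the four spatial coordinates, and then the norm itself kills the last one. -/
lemma eq_zero_of_mink_self_eq_zero {q w : R51} (hq : q ∈ hyperboloid) (hw : mink w q = 0)
    (h : mink w w = 0) : w = 0 := by
  have h1 := sum_sq_le_of_mink_eq_zero hq hw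
  rw [h, zero_mul] at h1
  have s0 := sq_nonneg (w 0)
  have s1 := sq_nonneg (w 1)
  have s2 := sq_nonneg (w 2)
  have s3 := sq_nonneg (w 3)
  have h0 : w 0 = 0 := pow_eq_zero_iff two_ne_zero |>.1 (by linarith)
  have h2 : w 1 = 0 := pow_eq_zero_iff two_ne_zero |>.1 (by linarith)
  have h3 : w 2 = 0 := pow_eq_zero_iff two_ne_zero |>.1 (by linarith)
  have h4 : w 3 = 0 := pow_eq_zero_iff two_ne_zero |>.1 (by linarith)
  have h5 : w 4 = 0 := by
    have : w 4 * w 4 = 0 := by simpa [mink, h0, h2, h3, h4] using h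
    exact mul_self_eq_zero.1 this
  ext i
  fin_cases i <;> simpa

lemma mink_self_nonneg {q w : R51} (hq : q ∈ hyperboloid) (hw : mink w q = 0) :
    0 ≤ mink w w := by
  by_contra! h
  have h1 := sum_sq_le_of_mink_eq_zero hq hw
  nlinarith [sq_nonneg (w 0), sq_nonneg (w 1), sq_nonneg (w 2), sq_nonneg (w 3), pow_pos hq.2 2]

end Minkowski

/-! ### Metric operations computed in an orthonormal frame -/

section Frame

variable {M : Type*} [TopologicalSpace M] [ChartedSpace (EuclideanSpace ℝ (Fin 2)) M]

lemma SmoothMap.mink {F G : M → R51} (hF : SmoothMap F) (hG : SmoothMap G) :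
    SmoothMap fun p => mink (F p) (G p) := by
  have h : ContDiff ℝ ∞ fun z : R51 × R51 => PNMC.mink z.1 z.2 := by
    unfold PNMC.mink; fun_prop
  exact h.contMDiff.comp (hF.prodMk_space hG)

lemma dd_coord {F : M → R51} {p : M} (hF : MDifferentiableAt (𝓡 2) 𝓘(ℝ, R51) F p) (i : Fin 5)
    (x : TS p) : dd (fun q => F q i) p x = dd F p x i :=
  dd_clm (EuclideanSpace.proj i : R51 →L[ℝ] ℝ) hF x

lemma MDifferentiableAt.coord {F : M → R51} {p : M}
    (hF : MDifferentiableAt (𝓡 2) 𝓘(ℝ, R51) F p) (i : Fin 5) :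
    MDifferentiableAt (𝓡 2) 𝓘(ℝ, ℝ) (fun q => F q i) p :=
  (EuclideanSpace.proj i : R51 →L[ℝ] ℝ).differentiableAt.mdifferentiableAt.comp p hF

lemma dd_mink {F G : M → R51} {p : M} (hF : MDifferentiableAt (𝓡 2) 𝓘(ℝ, R51) F p)
    (hG : MDifferentiableAt (𝓡 2) 𝓘(ℝ, R51) G p) (x : TS p) :
    dd (fun q => mink (F q) (G q)) p x = mink (dd F p x) (G p) + mink (F p) (dd G p x) := by
  have hm (i : Fin 5) := dd_mul (MDifferentiableAt.coord hF i) (MDifferentiableAt.coord hG i) x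
  have hd (i : Fin 5) : MDifferentiableAt (𝓡 2) 𝓘(ℝ, ℝ) (fun q => F q i * G q i) p :=
    (MDifferentiableAt.coord hF i).mul (MDifferentiableAt.coord hG i)
  have ha {u v : M → ℝ} (hu : MDifferentiableAt (𝓡 2) 𝓘(ℝ, ℝ) u p)
      (hv : MDifferentiableAt (𝓡 2) 𝓘(ℝ, ℝ) v p) :
      MDifferentiableAt (𝓡 2) 𝓘(ℝ, ℝ) (fun q => u q + v q) p := hu.add hv
  simp only [dd_coord hF, dd_coord hG] at hm
  unfold mink
  rw [dd_sub (ha (ha (ha (hd 0) (hd 1)) (hd 2)) (hd 3)) (hd 4),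
    dd_add (ha (ha (hd 0) (hd 1)) (hd 2)) (hd 3), dd_add (ha (hd 0) (hd 1)) (hd 2),
    dd_add (hd 0) (hd 1), hm, hm, hm, hm, hm]
  ring

/-- A `g`-orthonormal basis of `T_p M`. -/
structure IsONBasis (Φ : M → R51) (p : M) (X Y : TS p) : Prop where
  fst : met Φ p X X = 1
  orth : met Φ p X Y = 0
  snd : met Φ p Y Y = 1

variable {Φ : M → R51} {p : M} {X Y : TS p}

/-- Orthonormality alone forces independence, and two independent vectors span the tangent plane. -/
lemma IsONBasis.expand (h : IsONBasis Φ p X Y) (x : TS p) :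
    x = met Φ p x X • X + met Φ p x Y • Y := by
  have hli : LinearIndependent ℝ ![X, Y] := by
    rw [LinearIndependent.pair_iff]
    intro s t hst
    have h1 : dd Φ p (s • X + t • Y) = 0 := by rw [hst, dd_zero_right]
    rw [dd_add_right, dd_smul_right, dd_smul_right] at h1
    have hX := congrArg (fun w => mink w (dd Φ p X)) h1
    have hY := congrArg (fun w => mink w (dd Φ p Y)) h1
    have a := h.fst; have b := h.orth; have c := h.snd
    simp only [met] at a b c
    have b' := b; rw [mink_comm] at b'
    simp only [mink_add_left, mink_smul_left, mink_zero_left, a, b, c, b'] at hX hY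
    constructor <;> linarith
  have hsp : Submodule.span ℝ (Set.range ![X, Y]) = ⊤ :=
    hli.span_eq_top_of_card_eq_finrank (by
      change _ = Module.finrank ℝ (EuclideanSpace ℝ (Fin 2)); simp)
  have hx : x ∈ Submodule.span ℝ (Set.range ![X, Y]) := hsp ▸ Submodule.mem_top
  rw [Matrix.range_cons, Matrix.range_cons, Matrix.range_empty, Set.union_empty,
    Set.singleton_union, Submodule.mem_span_pair] at hx
  obtain ⟨s, t, rfl⟩ := hx
  have a := h.fst; have b := h.orth; have c := h.snd
  simp only [met] at a b c
  have b' := b; rw [mink_comm] at b'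
  simp [met, dd_add_right, dd_smul_right, mink_add_left, mink_smul_left, a, b, c, b']

/-- The coordinates of a tangent vector with respect to `bas`. -/
def coordTS (x : TS p) (i : Fin 2) : ℝ := (show EuclideanSpace ℝ (Fin 2) from x) i

lemma eq_sum_bas (x : TS p) : x = coordTS x 0 • bas p 0 + coordTS x 1 • bas p 1 := by
  have h (v : EuclideanSpace ℝ (Fin 2)) :
      v = v 0 • EuclideanSpace.single 0 (1 : ℝ) + v 1 • EuclideanSpace.single 1 (1 : ℝ) := by
    ext i
    fin_cases i <;> simp
  exact h x

/-- The dual metric is X ⊗ X + Y ⊗ Y, written in coordinates with respect to `bas`. It is what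
converts `sharp` and `tr` into frame formulas. -/
lemma IsONBasis.invMet_eq (h : IsONBasis Φ p X Y) (i j : Fin 2) :
    invMet Φ p i j = coordTS X i * coordTS X j + coordTS Y i * coordTS Y j := by
  suffices H : invMet Φ p =
      Matrix.of fun i j => coordTS X i * coordTS X j + coordTS Y i * coordTS Y j by
    rw [H]; rfl
  apply Matrix.inv_eq_left_inv
  have key (Z : TS p) (k : Fin 2) :
      ∑ j, coordTS Z j * met Φ p (bas p j) (bas p k) = met Φ p (bas p k) Z := by
    conv_rhs => rw [eq_sum_bas Z]
    simp only [met, dd_add_right, dd_smul_right, mink_add_left, mink_smul_left,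
      Fin.sum_univ_two, mink_comm (dd Φ p (bas p k))]
  ext i k
  -- The i-th coordinate of the expansion of `bas p k` in the frame: its left side is the Kronecker
  -- delta.
  have hk : (EuclideanSpace.single k (1 : ℝ) : EuclideanSpace ℝ (Fin 2)) i =
      met Φ p (bas p k) X * coordTS X i + met Φ p (bas p k) Y * coordTS Y i :=
    congrArg (fun z : EuclideanSpace ℝ (Fin 2) => z i) (h.expand (bas p k))
  rw [← key X, ← key Y] at hk
  simp only [Matrix.mul_apply, Matrix.of_apply, Matrix.one_apply]
  simp only [PiLp.single_apply] at hk
  rw [hk]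
  simp only [Fin.sum_univ_two]
  ring

lemma IsONBasis.sharp_eq (h : IsONBasis Φ p X Y) {α : TS p → ℝ}
    (hα : ∀ (a b : ℝ) (x y : TS p), α (a • x + b • y) = a * α x + b * α y) :
    sharp Φ p α = α X • X + α Y • Y := by
  conv_rhs => rw [eq_sum_bas X, eq_sum_bas Y]
  simp only [sharp, Fin.sum_univ_two, h.invMet_eq, hα]
  module

lemma IsONBasis.tr_eq (h : IsONBasis Φ p X Y) {β : TS p → TS p → R51}
    (hl : ∀ (a b : ℝ) (x y z : TS p), β (a • x + b • y) z = a • β x z + b • β y z)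
    (hr : ∀ (a b : ℝ) (x y z : TS p), β z (a • x + b • y) = a • β z x + b • β z y) :
    tr Φ p β = β X X + β Y Y := by
  conv_rhs => rw [eq_sum_bas X, eq_sum_bas Y]
  simp only [tr, Fin.sum_univ_two, h.invMet_eq, hl, hr]
  module

lemma IsONBasis.tan_eq (h : IsONBasis Φ p X Y) (w : R51) :
    tan Φ p w = mink w (dd Φ p X) • X + mink w (dd Φ p Y) • Y :=
  h.sharp_eq (α := fun x => mink w (dd Φ p x)) fun a b x y => by
    simp only [dd_add_right, dd_smul_right, mink_add_right, mink_smul_right]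

lemma IsONBasis.grad_eq (h : IsONBasis Φ p X Y) (u : M → ℝ) :
    grad Φ u p = dd u p X • X + dd u p Y • Y :=
  h.sharp_eq (α := fun x => dd u p x) fun a b x y => by
    simp only [dd_add_right, dd_smul_right, smul_eq_mul]

lemma IsONBasis.nor_eq (h : IsONBasis Φ p X Y) (w : R51) :
    nor Φ p w = w - (mink w (dd Φ p X) • dd Φ p X + mink w (dd Φ p Y) • dd Φ p Y) := by
  rw [nor, h.tan_eq, dd_add_right, dd_smul_right, dd_smul_right]

end Frame

/-! ### Curvature of the hyperboloid -/

section Curvature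

/-- The Minkowski product as a continuous bilinear map. -/
def minkCLM : R51 →L[ℝ] R51 →L[ℝ] ℝ :=
  (LinearMap.mk₂ ℝ mink (fun x y z => mink_add_left x y z) (fun c x z => mink_smul_left c x z)
    (fun z x y => mink_add_right x y z) (fun c z x => mink_smul_right c x z)).toContinuousBilinearMap

lemma fderiv_mink {A B : R51 → R51} {q : R51} (hA : DifferentiableAt ℝ A q)
    (hB : DifferentiableAt ℝ B q) (v : R51) :
    fderiv ℝ (fun q' => mink (A q') (B q')) q v =
      mink (fderiv ℝ A q v) (B q) + mink (A q) (fderiv ℝ B q v) := by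
  have h := (minkCLM.hasFDerivAt_of_bilinear hA.hasFDerivAt hB.hasFDerivAt).fderiv
  have h' := congrArg (fun L => L v) h
  refine h'.trans ?_
  change mink (A q) (fderiv ℝ B q v) + mink (fderiv ℝ A q v) (B q) = _
  ring

lemma differentiable_mink {A B : R51 → R51} (hA : Differentiable ℝ A) (hB : Differentiable ℝ B) :
    Differentiable ℝ fun q => mink (A q) (B q) := by
  unfold mink; fun_prop

lemma differentiable_projH {A : R51 → R51} (hA : Differentiable ℝ A) :
    Differentiable ℝ fun q => projH q (A q) := by
  have hm := differentiable_mink hA differentiable_id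
  unfold projH
  exact hA.add (hm.smul differentiable_id)

lemma fderiv_projH {A : R51 → R51} (hA : Differentiable ℝ A) (q v : R51) :
    fderiv ℝ (fun q' => projH q' (A q')) q v = fderiv ℝ A q v +
      ((mink (fderiv ℝ A q v) q + mink (A q) v) • q + mink (A q) q • v) := by
  have hm : Differentiable ℝ fun q' => mink (A q') q' := differentiable_mink hA differentiable_id
  have h1 : fderiv ℝ (fun q' => mink (A q') q') q v =
      mink (fderiv ℝ A q v) q + mink (A q) v := by
    have := fderiv_mink (hA q) differentiableAt_id v
    simpa using this
  unfold projH
  have hs : DifferentiableAt ℝ (fun q' => mink (A q') q' • q') q :=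
    (hm q).smul differentiableAt_fun_id
  rw [fderiv_fun_add (hA q) hs,
    fderiv_fun_smul (hm q) differentiableAt_fun_id]
  simp [h1, add_comm]

/-- `ℍ⁴` has constant sectional curvature `-1`. -/
lemma curvH_eq {q x y z : R51} (hq : mink q q = -1) (hx : mink x q = 0) (hy : mink y q = 0)
    (hz : mink z q = 0) : curvH q x y z = mink x z • y - mink y z • x := by
  have hd (w : R51) : Differentiable ℝ fun q' => projH q' w :=
    differentiable_projH (differentiable_const w)
  have hf (w q' v : R51) :
      fderiv ℝ (fun q' => projH q' w) q' v = mink w v • q' + mink w q' • v := by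
    rw [fderiv_projH (differentiable_const w)]
    simp [mink_zero_left]
  have hproj {w : R51} (hw : mink w q = 0) : projH q w = w := by simp [projH, hw]
  have hconn (u w : R51) : connH (fun q' => projH q' u) (fun q' => projH q' w) =
      fun q' => projH q' (mink w (projH q' u) • q' + mink w q' • projH q' u) := by
    funext q'
    rw [connH, hf]
  have key {u v w : R51} (hu : mink u q = 0) (hv : mink v q = 0) (hw : mink w q = 0) :
      connH (fun q' => projH q' u) (connH (fun q' => projH q' v) (fun q' => projH q' w)) q =
        mink w u • v := by
    have hm1 : Differentiable ℝ fun q' => mink w (projH q' v) :=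
      differentiable_mink (differentiable_const w) (hd v)
    have hm2 : Differentiable ℝ fun q' => mink w q' :=
      differentiable_mink (differentiable_const w) differentiable_id
    have hA : Differentiable ℝ fun q' => mink w (projH q' v) • q' + mink w q' • projH q' v :=
      (hm1.smul differentiable_id).add (hm2.smul (hd v))
    have e1 : fderiv ℝ (fun q' => mink w (projH q' v)) q u = mink v u * mink w q := by
      rw [fderiv_mink (differentiableAt_const w) (hd v q), hf]
      simp [mink_zero_left, mink_smul_right, hv]
    have e2 : fderiv ℝ (fun q' => mink w q') q u = mink w u := by
      have := fderiv_mink (differentiableAt_const w) (differentiableAt_id (x := q)) u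
      simpa [mink_zero_left] using this
    have e3 : fderiv ℝ (fun q' => mink w (projH q' v) • q' + mink w q' • projH q' v) q u =
        mink w v • u + mink w u • v := by
      have hs1 : DifferentiableAt ℝ (fun q' => mink w (projH q' v) • q') q :=
        (hm1 q).smul differentiableAt_fun_id
      have hs2 : DifferentiableAt ℝ (fun q' => mink w q' • projH q' v) q := (hm2 q).smul (hd v q)
      rw [fderiv_fun_add hs1 hs2,
        fderiv_fun_smul (hm1 q) differentiableAt_fun_id, fderiv_fun_smul (hm2 q) (hd v q)]
      simp [e1, e2, hw, hproj hv]
    -- At `q` the derivative of the inner projection contributes -⟨w, v⟩u, cancelling the first term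
    -- of `e3`; the outer projection removes the multiples of `q`.
    rw [hconn, connH, fderiv_projH hA, hproj hu, e3]
    have hqu : mink q u = 0 := by rw [mink_comm, hu]
    simp only [projH, mink_add_left, mink_smul_left, hu, hv, hw, hq, hqu]
    simp
  -- The two cross derivatives at `q` are ⟨y, x⟩q and ⟨x, y⟩q, so the bracket vanishes there by
  -- symmetry.
  have hlie : VectorField.lieBracket ℝ (fun q' => projH q' x) (fun q' => projH q' y) q = 0 := by
    rw [VectorField.lieBracket, hf, hf, hproj hx, hproj hy, hx, hy, mink_comm]
    simp
  have hlast : connH (VectorField.lieBracket ℝ (fun q' => projH q' x) (fun q' => projH q' y))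
      (fun q' => projH q' z) q = 0 := by
    rw [connH, hlie]
    simp [projH, mink_zero_left]
  rw [curvH]
  rw [key hx hy hz, key hy hx hz, hlast, mink_comm z x, mink_comm z y, sub_zero]

end Curvature

/-! ### Second fundamental form, mean curvature and bitension field in a frame -/

section Surface

variable {M : Type*} [TopologicalSpace M] [ChartedSpace (EuclideanSpace ℝ (Fin 2)) M]

variable {Φ : M → R51} {E₁ E₂ : (p : M) → TS p}

lemma mink_dd_self_of_mem_hyperboloid (hs : SmoothMap Φ) (hm : ∀ p, Φ p ∈ hyperboloid) (p : M)
    (x : TS p) : mink (dd Φ p x) (Φ p) = 0 := by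
  have h := dd_mink (hs.mdiff p) (hs.mdiff p) x
  have hc : (fun q => mink (Φ q) (Φ q)) = fun _ => (-1 : ℝ) := funext fun q => (hm q).1
  rw [hc, dd_const, mink_comm (Φ p)] at h
  linarith

lemma nablaPhi_eq_of_mink_eq_zero {V : M → R51} {p : M} {x : TS p}
    (hV : mink (dd V p x) (Φ p) = 0) : nablaPhi Φ p x V = dd V p x := by
  simp [nablaPhi, projH, hV]

/-- Derivative of a combination of two smooth maps whose coefficients are Minkowski products with
a constant vector. -/
lemma dd_mink_smul_add {u v F G : M → R51} (hu : SmoothMap u) (hv : SmoothMap v)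
    (hF : SmoothMap F) (hG : SmoothMap G) (w : R51) (p : M) (x : TS p) :
    dd (fun q => mink w (u q) • F q + mink w (v q) • G q) p x =
      mink w (dd u p x) • F p + mink w (u p) • dd F p x +
        (mink w (dd v p x) • G p + mink w (v p) • dd G p x) := by
  have hc : SmoothMap fun _ : M => w := smoothMap_const w
  have h1 := hc.mink hu
  have h2 := hc.mink hv
  rw [dd_add ((SmoothMap.fun_smul h1 hF).mdiff p) ((SmoothMap.fun_smul h2 hG).mdiff p),
    dd_smul (h1.mdiff p) (hF.mdiff p), dd_smul (h2.mdiff p) (hG.mdiff p),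
    dd_mink (hc.mdiff p) (hu.mdiff p), dd_mink (hc.mdiff p) (hv.mdiff p), dd_const]
  simp only [mink_zero_left, zero_add]

variable [IsManifold (𝓡 2) ∞ M]

/-- A smooth immersed surface in `ℍ⁴` with a smooth orthonormal frame field. -/
structure IsFramed (Φ : M → R51) (E₁ E₂ : (p : M) → TS p) : Prop where
  smooth : SmoothMap Φ
  mem_hyperboloid : ∀ p, Φ p ∈ hyperboloid
  smooth_fst : SmoothField E₁
  smooth_snd : SmoothField E₂
  basis : ∀ p, IsONBasis Φ p (E₁ p) (E₂ p)

namespace IsFramed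

lemma mink_dd_self (h : IsFramed Φ E₁ E₂) (p : M) (x : TS p) : mink (dd Φ p x) (Φ p) = 0 :=
  mink_dd_self_of_mem_hyperboloid h.smooth h.mem_hyperboloid p x

lemma smooth_push_fst (h : IsFramed Φ E₁ E₂) : SmoothMap (push Φ E₁) :=
  h.smooth_fst.smooth_dd h.smooth

lemma smooth_push_snd (h : IsFramed Φ E₁ E₂) : SmoothMap (push Φ E₂) :=
  h.smooth_snd.smooth_dd h.smooth

/-- The coefficients of the extension are products with a constant vector, so its derivative is
explicit (`dd_mink_smul_add`). -/
lemma push_ext (h : IsFramed Φ E₁ E₂) (p : M) (y : TS p) :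
    push Φ (ext Φ p y) = fun q => mink (dd Φ p y) (push Φ E₁ q) • push Φ E₁ q +
      mink (dd Φ p y) (push Φ E₂ q) • push Φ E₂ q := by
  funext q
  rw [push, ext, (h.basis q).tan_eq, dd_add_right, dd_smul_right, dd_smul_right]
  rfl

/-- Projection onto the normal bundle inside ℍ⁴: the components along Φ, E₁, E₂ are removed, with a
plus sign for Φ because ⟨Φ, Φ⟩ = -1. -/
lemma nor_projH (h : IsFramed Φ E₁ E₂) (p : M) (w : R51) :
    nor Φ p (projH (Φ p) w) = w + mink w (Φ p) • Φ p -
      (mink w (push Φ E₁ p) • push Φ E₁ p + mink w (push Φ E₂ p) • push Φ E₂ p) := by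
  have h1 := h.mink_dd_self p (E₁ p)
  have h2 := h.mink_dd_self p (E₂ p)
  rw [mink_comm] at h1 h2
  rw [(h.basis p).nor_eq, projH]
  simp only [mink_add_left, mink_smul_left, h1, h2, mul_zero, add_zero]
  rfl

lemma nor_push_fst (h : IsFramed Φ E₁ E₂) (p : M) :
    nor Φ p (projH (Φ p) (push Φ E₁ p)) = 0 := by
  have h1 := h.mink_dd_self p (E₁ p)
  have a := (h.basis p).fst
  have b := (h.basis p).orth
  change mink (push Φ E₁ p) (Φ p) = 0 at h1
  change mink (push Φ E₁ p) (push Φ E₁ p) = 1 at a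
  change mink (push Φ E₁ p) (push Φ E₂ p) = 0 at b
  rw [h.nor_projH, h1, a, b]
  module

lemma nor_push_snd (h : IsFramed Φ E₁ E₂) (p : M) :
    nor Φ p (projH (Φ p) (push Φ E₂ p)) = 0 := by
  have h1 := h.mink_dd_self p (E₂ p)
  have a := (h.basis p).snd
  have b := (h.basis p).orth
  change mink (push Φ E₂ p) (Φ p) = 0 at h1
  change mink (push Φ E₂ p) (push Φ E₂ p) = 1 at a
  change mink (push Φ E₁ p) (push Φ E₂ p) = 0 at b
  rw [mink_comm] at b
  rw [h.nor_projH, h1, a, b]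
  module

lemma nor_projH_add (h : IsFramed Φ E₁ E₂) (p : M) (v w : R51) :
    nor Φ p (projH (Φ p) (v + w)) = nor Φ p (projH (Φ p) v) + nor Φ p (projH (Φ p) w) := by
  simp only [h.nor_projH, mink_add_left]
  module

lemma nor_projH_smul (h : IsFramed Φ E₁ E₂) (p : M) (c : ℝ) (w : R51) :
    nor Φ p (projH (Φ p) (c • w)) = c • nor Φ p (projH (Φ p) w) := by
  simp only [h.nor_projH, mink_smul_left]
  module

/-- Derivatives of the coefficients of the extension multiply tangent vectors, which the normal
projection kills. The bilinearity required by `IsONBasis.tr_eq` is visible in this form. -/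
lemma sff_eq (h : IsFramed Φ E₁ E₂) (p : M) (x y : TS p) :
    sff Φ p x y =
      mink (dd Φ p y) (push Φ E₁ p) • nor Φ p (projH (Φ p) (dd (push Φ E₁) p x)) +
      mink (dd Φ p y) (push Φ E₂ p) • nor Φ p (projH (Φ p) (dd (push Φ E₂) p x)) := by
  rw [sff, nablaPhi, h.push_ext, dd_mink_smul_add h.smooth_push_fst h.smooth_push_snd
    h.smooth_push_fst h.smooth_push_snd]
  simp only [h.nor_projH_add, h.nor_projH_smul, h.nor_push_fst, h.nor_push_snd]
  module

lemma meanCurv_eq (h : IsFramed Φ E₁ E₂) (p : M) :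
    meanCurv Φ p = (1 / 2 : ℝ) • nor Φ p (projH (Φ p)
      (dd (push Φ E₁) p (E₁ p) + dd (push Φ E₂) p (E₂ p))) := by
  have a : mink (dd Φ p (E₁ p)) (push Φ E₁ p) = 1 := (h.basis p).fst
  have b : mink (dd Φ p (E₁ p)) (push Φ E₂ p) = 0 := (h.basis p).orth
  have c : mink (dd Φ p (E₂ p)) (push Φ E₂ p) = 1 := (h.basis p).snd
  have b' : mink (dd Φ p (E₂ p)) (push Φ E₁ p) = 0 := by rw [mink_comm]; exact b
  rw [meanCurv, (h.basis p).tr_eq, h.sff_eq, h.sff_eq, a, b, c, b', h.nor_projH_add]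
  · module
  · intro s t x y z
    simp only [h.sff_eq, dd_add_right, dd_smul_right, h.nor_projH_add, h.nor_projH_smul]
    module
  · intro s t x y z
    simp only [h.sff_eq, dd_add_right, dd_smul_right, mink_add_left, mink_smul_left]
    module

/-- The first two terms depend on the derivatives of the extension; in `hessian_eq` they cancel
against those of the iterated derivative. -/
lemma nablaM_ext (h : IsFramed Φ E₁ E₂) (p : M) (x y : TS p) :
    nablaM Φ p x (ext Φ p y) =
      mink (dd Φ p y) (dd (push Φ E₁) p x) • E₁ p + mink (dd Φ p y) (dd (push Φ E₂) p x) • E₂ p +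
      (mink (dd Φ p y) (push Φ E₁ p) • tan Φ p (dd (push Φ E₁) p x) +
        mink (dd Φ p y) (push Φ E₂ p) • tan Φ p (dd (push Φ E₂) p x)) := by
  have a : mink (push Φ E₁ p) (dd Φ p (E₁ p)) = 1 := (h.basis p).fst
  have b : mink (push Φ E₁ p) (dd Φ p (E₂ p)) = 0 := (h.basis p).orth
  have c : mink (push Φ E₂ p) (dd Φ p (E₂ p)) = 1 := (h.basis p).snd
  have b' : mink (push Φ E₂ p) (dd Φ p (E₁ p)) = 0 := by rw [mink_comm]; exact b
  rw [nablaM, h.push_ext, dd_mink_smul_add h.smooth_push_fst h.smooth_push_snd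
    h.smooth_push_fst h.smooth_push_snd]
  simp only [(h.basis p).tan_eq, mink_add_left, mink_smul_left, a, b, c, b']
  module

/-- The second covariant derivative in the rough Laplacian, for a section that is normal to the
surface. -/
lemma hessian_eq (h : IsFramed Φ E₁ E₂) {V : M → R51} (hs : SmoothMap V)
    (hV : ∀ p x, mink (dd V p x) (Φ p) = 0) (p : M) (x y : TS p) :
    nablaPhi Φ p x (fun q => nablaPhi Φ q (ext Φ p y q) V) -
      nablaPhi Φ p (nablaM Φ p x (ext Φ p y)) V =
    mink (dd Φ p y) (push Φ E₁ p) • (projH (Φ p) (dd (fun q => dd V q (E₁ q)) p x) -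
        dd V p (tan Φ p (dd (push Φ E₁) p x))) +
      mink (dd Φ p y) (push Φ E₂ p) • (projH (Φ p) (dd (fun q => dd V q (E₂ q)) p x) -
        dd V p (tan Φ p (dd (push Φ E₂) p x))) := by
  have h1 : (fun q => nablaPhi Φ q (ext Φ p y q) V) = fun q =>
      mink (dd Φ p y) (push Φ E₁ q) • dd V q (E₁ q) +
        mink (dd Φ p y) (push Φ E₂ q) • dd V q (E₂ q) := by
    funext q
    rw [nablaPhi_eq_of_mink_eq_zero (hV _ _), ext, (h.basis q).tan_eq, dd_add_right,
      dd_smul_right, dd_smul_right]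
    rfl
  rw [h1, nablaPhi_eq_of_mink_eq_zero (hV _ _), nablaPhi, dd_mink_smul_add h.smooth_push_fst
    h.smooth_push_snd (h.smooth_fst.smooth_dd hs) (h.smooth_snd.smooth_dd hs), h.nablaM_ext]
  simp only [projH, dd_add_right, dd_smul_right, mink_add_left, mink_smul_left, hV]
  module

/-- In constant curvature -1 the curvature trace is 2τ, which is normal and drops out; so do the
multiples of Φ introduced by `projH`. Only flat second derivatives remain. -/
lemma tan_bitension (h : IsFramed Φ E₁ E₂) (hs : SmoothMap (tension Φ))
    (ht : ∀ p, mink (tension Φ p) (Φ p) = 0)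
    (hn : ∀ p x, mink (tension Φ p) (dd Φ p x) = 0) (p : M) :
    tan Φ p (bitension Φ p) = tan Φ p (
      (dd (fun q => dd (tension Φ) q (E₁ q)) p (E₁ p) -
        dd (tension Φ) p (tan Φ p (dd (push Φ E₁) p (E₁ p)))) +
      (dd (fun q => dd (tension Φ) q (E₂ q)) p (E₂ p) -
        dd (tension Φ) p (tan Φ p (dd (push Φ E₂) p (E₂ p))))) := by
  have hV : ∀ p x, mink (dd (tension Φ) p x) (Φ p) = 0 := by
    intro p x
    have h1 := dd_mink (hs.mdiff p) (h.smooth.mdiff p) x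
    rw [funext ht, dd_const, hn] at h1
    linarith
  have a : mink (dd Φ p (E₁ p)) (push Φ E₁ p) = 1 := (h.basis p).fst
  have b : mink (dd Φ p (E₁ p)) (push Φ E₂ p) = 0 := (h.basis p).orth
  have c : mink (dd Φ p (E₂ p)) (push Φ E₂ p) = 1 := (h.basis p).snd
  have b' : mink (dd Φ p (E₂ p)) (push Φ E₁ p) = 0 := by rw [mink_comm]; exact b
  have hcurv : (fun x y => curvH (Φ p) (dd Φ p x) (tension Φ p) (dd Φ p y)) =
      fun x y => mink (dd Φ p x) (dd Φ p y) • tension Φ p := by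
    funext x y
    rw [curvH_eq (h.mem_hyperboloid p).1 (h.mink_dd_self p x) (ht p) (h.mink_dd_self p y), hn]
    simp
  have htr : tr Φ p (fun x y => curvH (Φ p) (dd Φ p x) (tension Φ p) (dd Φ p y)) =
      (2 : ℝ) • tension Φ p := by
    have a' : mink (dd Φ p (E₁ p)) (dd Φ p (E₁ p)) = 1 := a
    have c' : mink (dd Φ p (E₂ p)) (dd Φ p (E₂ p)) = 1 := c
    rw [hcurv, (h.basis p).tr_eq, a', c']
    · module
    · intro s t x y z
      simp only [dd_add_right, dd_smul_right, mink_add_left, mink_smul_left]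
      module
    · intro s t x y z
      simp only [dd_add_right, dd_smul_right, mink_add_right, mink_smul_right]
      module
  rw [bitension, roughLap, htr]
  simp only [h.hessian_eq hs hV]
  rw [(h.basis p).tr_eq, a, b, c, b']
  · have h1 := h.mink_dd_self p (E₁ p)
    have h2 := h.mink_dd_self p (E₂ p)
    rw [mink_comm] at h1 h2
    simp only [(h.basis p).tan_eq, mink_sub_left, mink_neg_left, mink_add_left, mink_smul_left,
      hn, projH, h1, h2]
    module
  · intro s t x y z
    simp only [(h.basis p).tan_eq, projH, dd_add_right, dd_smul_right, mink_add_left,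
      mink_smul_left]
    module
  · intro s t x y z
    simp only [dd_add_right, dd_smul_right, mink_add_left, mink_smul_left]
    module

end IsFramed
end Surface

/-! ### Weingarten, Codazzi and the biconservative equation -/

section Structure

variable {M : Type*} [TopologicalSpace M] [ChartedSpace (EuclideanSpace ℝ (Fin 2)) M]
  {Φ : M → R51} {E₁ E₂ : (p : M) → TS p}

/-- Derivatives of orthogonal maps. -/
lemma mink_dd_add_mink_dd {F G : M → R51} (hF : SmoothMap F) (hG : SmoothMap G) {c : ℝ}
    (hFG : ∀ p, mink (F p) (G p) = c) (p : M) (x : TS p) :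
    mink (dd F p x) (G p) + mink (F p) (dd G p x) = 0 := by
  rw [← dd_mink (hF.mdiff p) (hG.mdiff p), funext hFG, dd_const]

/-- Derivative of a combination of two smooth maps. -/
lemma dd_smul_add_smul {u v : M → ℝ} {F G : M → R51} (hu : SmoothMap u) (hv : SmoothMap v)
    (hF : SmoothMap F) (hG : SmoothMap G) (p : M) (x : TS p) :
    dd (fun q => u q • F q + v q • G q) p x =
      dd u p x • F p + u p • dd F p x + (dd v p x • G p + v p • dd G p x) := by
  rw [dd_add ((hu.fun_smul hF).mdiff p) ((hv.fun_smul hG).mdiff p),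
    dd_smul (hu.mdiff p) (hF.mdiff p), dd_smul (hv.mdiff p) (hG.mdiff p)]

lemma IsONBasis.mink_eq_zero_of_tan_eq_zero {p : M} {X Y : TS p} (h : IsONBasis Φ p X Y) {w : R51}
    (hw : tan Φ p w = 0) : mink w (dd Φ p X) = 0 ∧ mink w (dd Φ p Y) = 0 := by
  have a : mink (dd Φ p X) (dd Φ p X) = 1 := h.fst
  have b : mink (dd Φ p X) (dd Φ p Y) = 0 := h.orth
  have c : mink (dd Φ p Y) (dd Φ p Y) = 1 := h.snd
  have b' : mink (dd Φ p Y) (dd Φ p X) = 0 := by rw [mink_comm]; exact b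
  have h1 := congrArg (dd Φ p) (h.tan_eq w)
  rw [hw, dd_zero_right, dd_add_right, dd_smul_right, dd_smul_right] at h1
  have hX := congrArg (fun z => mink z (dd Φ p X)) h1
  have hY := congrArg (fun z => mink z (dd Φ p Y)) h1
  simp only [mink_zero_left, mink_add_left, mink_smul_left, a, b, c, b'] at hX hY
  constructor <;> linarith

variable [IsManifold (𝓡 2) ∞ M]

/-- The coefficient `⟨∇_X X, Y⟩` of the Levi-Civita connection in a frame `X, Y`. -/
def connCoeff (Φ : M → R51) (X Y : (p : M) → TS p) (p : M) : ℝ :=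
  mink (accel Φ X p) (push Φ Y p)

namespace IsFramed

lemma mink_fst_fst (h : IsFramed Φ E₁ E₂) (p : M) : mink (push Φ E₁ p) (push Φ E₁ p) = 1 :=
  (h.basis p).fst

lemma mink_fst_snd (h : IsFramed Φ E₁ E₂) (p : M) : mink (push Φ E₁ p) (push Φ E₂ p) = 0 :=
  (h.basis p).orth

lemma mink_snd_fst (h : IsFramed Φ E₁ E₂) (p : M) : mink (push Φ E₂ p) (push Φ E₁ p) = 0 := by
  rw [mink_comm]; exact (h.basis p).orth

lemma mink_snd_snd (h : IsFramed Φ E₁ E₂) (p : M) : mink (push Φ E₂ p) (push Φ E₂ p) = 1 :=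
  (h.basis p).snd

lemma mink_dd_fst_fst (h : IsFramed Φ E₁ E₂) (p : M) (x : TS p) :
    mink (dd (push Φ E₁) p x) (push Φ E₁ p) = 0 := by
  have := mink_dd_add_mink_dd h.smooth_push_fst h.smooth_push_fst h.mink_fst_fst p x
  rw [mink_comm (push Φ E₁ p)] at this
  linarith

lemma mink_dd_snd_snd (h : IsFramed Φ E₁ E₂) (p : M) (x : TS p) :
    mink (dd (push Φ E₂) p x) (push Φ E₂ p) = 0 := by
  have := mink_dd_add_mink_dd h.smooth_push_snd h.smooth_push_snd h.mink_snd_snd p x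
  rw [mink_comm (push Φ E₂ p)] at this
  linarith

lemma mink_dd_snd_fst (h : IsFramed Φ E₁ E₂) (p : M) (x : TS p) :
    mink (dd (push Φ E₂) p x) (push Φ E₁ p) = -mink (dd (push Φ E₁) p x) (push Φ E₂ p) := by
  have := mink_dd_add_mink_dd h.smooth_push_fst h.smooth_push_snd h.mink_fst_snd p x
  rw [mink_comm (push Φ E₁ p)] at this
  linarith

/-- Table of the connection coefficients. -/
lemma mink_connection (h : IsFramed Φ E₁ E₂) (p : M) :
    mink (dd (push Φ E₁) p (E₁ p)) (push Φ E₂ p) = connCoeff Φ E₁ E₂ p ∧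
    mink (dd (push Φ E₂) p (E₁ p)) (push Φ E₁ p) = -connCoeff Φ E₁ E₂ p ∧
    mink (dd (push Φ E₂) p (E₂ p)) (push Φ E₁ p) = connCoeff Φ E₂ E₁ p ∧
    mink (dd (push Φ E₁) p (E₂ p)) (push Φ E₂ p) = -connCoeff Φ E₂ E₁ p := by
  refine ⟨rfl, h.mink_dd_snd_fst p _, rfl, ?_⟩
  have := h.mink_dd_snd_fst p (E₂ p)
  change connCoeff Φ E₂ E₁ p = _ at this
  linarith

lemma smooth_connCoeff_snd (h : IsFramed Φ E₁ E₂) : SmoothMap (connCoeff Φ E₂ E₁) :=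
  (h.smooth_snd.smooth_dd h.smooth_push_snd).mink h.smooth_push_fst

/-- The commutator `[E₁, E₂]`: the connection is torsion free. -/
lemma commutator (h : IsFramed Φ E₁ E₂) {E : Type} [NormedAddCommGroup E] [NormedSpace ℝ E]
    {F : M → E} (hF : SmoothMap F) (p : M) :
    dd (fun q => dd F q (E₂ q)) p (E₁ p) - dd (fun q => dd F q (E₁ q)) p (E₂ p) =
      -connCoeff Φ E₁ E₂ p • dd F p (E₁ p) + connCoeff Φ E₂ E₁ p • dd F p (E₂ p) := by
  obtain ⟨Z, hZ⟩ := h.smooth_fst.exists_commutator h.smooth_snd p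
  -- The same `Z` works for all maps, so testing it on Φ determines its frame components.
  have h1 := hZ Φ h.smooth
  change dd (push Φ E₂) p (E₁ p) - dd (push Φ E₁) p (E₂ p) = _ at h1
  obtain ⟨t1, t2, t3, t4⟩ := h.mink_connection p
  have h2 := (h.basis p).expand Z
  have e1 : met Φ p Z (E₁ p) = -connCoeff Φ E₁ E₂ p := by
    change mink (dd Φ p Z) (push Φ E₁ p) = _
    rw [← h1, mink_sub_left, t2, h.mink_dd_fst_fst, sub_zero]
  have e2 : met Φ p Z (E₂ p) = connCoeff Φ E₂ E₁ p := by
    change mink (dd Φ p Z) (push Φ E₂ p) = _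
    rw [← h1, mink_sub_left, t4, h.mink_dd_snd_snd]
    ring
  rw [e1, e2] at h2
  rw [hZ F hF, h2, dd_add_right, dd_smul_right, dd_smul_right]

lemma tan_accel_fst (h : IsFramed Φ E₁ E₂) (p : M) :
    tan Φ p (dd (push Φ E₁) p (E₁ p)) = connCoeff Φ E₁ E₂ p • E₂ p := by
  rw [(h.basis p).tan_eq]
  change mink _ (push Φ E₁ p) • _ + connCoeff Φ E₁ E₂ p • _ = _
  rw [h.mink_dd_fst_fst]
  module

lemma tan_accel_snd (h : IsFramed Φ E₁ E₂) (p : M) :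
    tan Φ p (dd (push Φ E₂) p (E₂ p)) = connCoeff Φ E₂ E₁ p • E₁ p := by
  rw [(h.basis p).tan_eq]
  change connCoeff Φ E₂ E₁ p • _ + mink _ (push Φ E₂ p) • _ = _
  rw [h.mink_dd_snd_snd]
  module

end IsFramed

/-- A framed surface with a unit normal field `n` that is parallel in the normal bundle, and such
that the mean curvature vector field is `f n`. -/
structure HasParallelMeanCurv (Φ : M → R51) (E₁ E₂ : (p : M) → TS p) (f : M → ℝ) (n : M → R51) :
    Prop extends IsFramed Φ E₁ E₂ where
  smooth_fun : SmoothMap f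
  smooth_normal : SmoothMap n
  unit_normal : ∀ p, mink (n p) (n p) = 1
  normal_self : ∀ p, mink (n p) (Φ p) = 0
  normal_fst : ∀ p, mink (n p) (push Φ E₁ p) = 0
  normal_snd : ∀ p, mink (n p) (push Φ E₂ p) = 0
  parallel : ∀ p x, nor Φ p (projH (Φ p) (dd n p x)) = 0
  meanCurv_eq_smul : ∀ p, meanCurv Φ p = f p • n p

/-- Entries of the matrix of `d n` (up to sign, of the shape operator) in a frame. -/
def shape (Φ : M → R51) (n : M → R51) (X Y : (p : M) → TS p) (p : M) : ℝ :=
  mink (dd n p (X p)) (push Φ Y p)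

namespace HasParallelMeanCurv

variable {f : M → ℝ} {n : M → R51}

/-- Weingarten formula. -/
lemma dd_normal (h : HasParallelMeanCurv Φ E₁ E₂ f n) {X : (p : M) → TS p} (p : M) :
    dd n p (X p) = shape Φ n X E₁ p • push Φ E₁ p + shape Φ n X E₂ p • push Φ E₂ p := by
  have h1 := h.parallel p (X p)
  have h0 : mink (n p) (dd Φ p (X p)) = 0 := by
    rw [(h.basis p).expand (X p), dd_add_right, dd_smul_right, dd_smul_right, mink_add_right,
      mink_smul_right, mink_smul_right]
    change _ * mink (n p) (push Φ E₁ p) + _ * mink (n p) (push Φ E₂ p) = 0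
    rw [h.normal_fst, h.normal_snd]
    ring
  have h2 := mink_dd_add_mink_dd h.smooth_normal h.smooth h.normal_self p (X p)
  rw [h0, add_zero] at h2
  rw [h.nor_projH, h2, zero_smul, add_zero, sub_eq_zero] at h1
  exact h1

lemma smooth_shape (h : HasParallelMeanCurv Φ E₁ E₂ f n) {X Y : (p : M) → TS p}
    (hX : SmoothField X) (hY : SmoothField Y) : SmoothMap (shape Φ n X Y) :=
  (hX.smooth_dd h.smooth_normal).mink (hY.smooth_dd h.smooth)

lemma shape_eq_neg (h : HasParallelMeanCurv Φ E₁ E₂ f n) {X Y : (p : M) → TS p}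
    (hY : SmoothField Y) (hn : ∀ p, mink (n p) (push Φ Y p) = 0) (p : M) :
    shape Φ n X Y p = -mink (n p) (dd (push Φ Y) p (X p)) := by
  have := mink_dd_add_mink_dd h.smooth_normal (hY.smooth_dd h.smooth) hn p (X p)
  change shape Φ n X Y p + mink (n p) (dd (push Φ Y) p (X p)) = 0 at this
  linarith

/-- The commutator of the frame applied to Φ is tangent, hence orthogonal to `n`. -/
lemma shape_symm (h : HasParallelMeanCurv Φ E₁ E₂ f n) (p : M) :
    shape Φ n E₁ E₂ p = shape Φ n E₂ E₁ p := by
  have h1 := h.commutator h.smooth p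
  change dd (push Φ E₂) p (E₁ p) - dd (push Φ E₁) p (E₂ p) =
    _ • push Φ E₁ p + _ • push Φ E₂ p at h1
  have h2 := congrArg (mink (n p)) h1
  rw [mink_sub_right, mink_add_right, mink_smul_right, mink_smul_right, h.normal_fst,
    h.normal_snd] at h2
  rw [h.shape_eq_neg h.smooth_snd h.normal_snd, h.shape_eq_neg h.smooth_fst h.normal_fst]
  linarith

/-- The trace of the second fundamental form. -/
lemma accel_add_accel (h : HasParallelMeanCurv Φ E₁ E₂ f n) (p : M) :
    accel Φ E₁ p + accel Φ E₂ p = (2 * f p) • n p + (2 : ℝ) • Φ p +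
      connCoeff Φ E₂ E₁ p • push Φ E₁ p + connCoeff Φ E₁ E₂ p • push Φ E₂ p := by
  have h1 := h.toIsFramed.meanCurv_eq p
  rw [h.meanCurv_eq_smul, h.nor_projH] at h1
  change _ = (1 / 2 : ℝ) • (accel Φ E₁ p + accel Φ E₂ p + mink (accel Φ E₁ p + accel Φ E₂ p) _ • _ -
    (mink (accel Φ E₁ p + accel Φ E₂ p) _ • _ + mink (accel Φ E₁ p + accel Φ E₂ p) _ • _)) at h1
  have h2 : mink (accel Φ E₁ p) (push Φ E₁ p) = 0 := h.mink_dd_fst_fst p (E₁ p)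
  have h3 : mink (accel Φ E₂ p) (push Φ E₂ p) = 0 := h.mink_dd_snd_snd p (E₂ p)
  -- Differentiate ⟨E₁, Φ⟩ = 0 along E₁; this value and its analogue for E₂ produce the term 2Φ.
  have h4 : mink (accel Φ E₁ p) (Φ p) = -1 := by
    have := mink_dd_add_mink_dd h.smooth_push_fst h.smooth (fun q => h.mink_dd_self q (E₁ q)) p (E₁ p)
    have h5 : mink (push Φ E₁ p) (dd Φ p (E₁ p)) = 1 := h.mink_fst_fst p
    rw [h5] at this
    change mink (accel Φ E₁ p) (Φ p) + 1 = 0 at this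
    linarith
  have h5 : mink (accel Φ E₂ p) (Φ p) = -1 := by
    have := mink_dd_add_mink_dd h.smooth_push_snd h.smooth (fun q => h.mink_dd_self q (E₂ q)) p (E₂ p)
    have h5 : mink (push Φ E₂ p) (dd Φ p (E₂ p)) = 1 := h.mink_snd_snd p
    rw [h5] at this
    change mink (accel Φ E₂ p) (Φ p) + 1 = 0 at this
    linarith
  simp only [mink_add_left, h2, h3, h4, h5] at h1
  change _ = (1 / 2 : ℝ) • (accel Φ E₁ p + accel Φ E₂ p + _ -
    ((0 + connCoeff Φ E₂ E₁ p) • _ + (connCoeff Φ E₁ E₂ p + 0) • _)) at h1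
  have h6 := congrArg (fun z => (2 : ℝ) • z) h1
  simp only [smul_smul] at h6
  rw [h6]
  module

lemma shape_trace (h : HasParallelMeanCurv Φ E₁ E₂ f n) (p : M) :
    shape Φ n E₁ E₁ p + shape Φ n E₂ E₂ p = -2 * f p := by
  rw [h.shape_eq_neg h.smooth_snd h.normal_snd, h.shape_eq_neg h.smooth_fst h.normal_fst]
  change -mink (n p) (accel Φ E₁ p) + -mink (n p) (accel Φ E₂ p) = _
  have h1 := congrArg (mink (n p)) (h.accel_add_accel p)
  simp only [mink_add_right, mink_smul_right, h.unit_normal, h.normal_self, h.normal_fst,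
    h.normal_snd] at h1
  linarith

lemma dd_dd_normal (h : HasParallelMeanCurv Φ E₁ E₂ f n) {X : (p : M) → TS p} (hX : SmoothField X)
    (p : M) (x : TS p) : dd (fun q => dd n q (X q)) p x =
      dd (shape Φ n X E₁) p x • push Φ E₁ p + shape Φ n X E₁ p • dd (push Φ E₁) p x +
        (dd (shape Φ n X E₂) p x • push Φ E₂ p + shape Φ n X E₂ p • dd (push Φ E₂) p x) := by
  have h1 : (fun q => dd n q (X q)) = fun q =>
      shape Φ n X E₁ q • push Φ E₁ q + shape Φ n X E₂ q • push Φ E₂ q :=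
    funext fun q => h.dd_normal q
  rw [h1, dd_smul_add_smul (h.smooth_shape hX h.smooth_fst) (h.smooth_shape hX h.smooth_snd)
    h.smooth_push_fst h.smooth_push_snd]

/-- The Codazzi equations for `n`. -/
lemma codazzi (h : HasParallelMeanCurv Φ E₁ E₂ f n) (p : M) :
    dd (shape Φ n E₂ E₁) p (E₁ p) - connCoeff Φ E₁ E₂ p * shape Φ n E₂ E₂ p -
      dd (shape Φ n E₁ E₁) p (E₂ p) - connCoeff Φ E₂ E₁ p * shape Φ n E₁ E₂ p +
      connCoeff Φ E₁ E₂ p * shape Φ n E₁ E₁ p - connCoeff Φ E₂ E₁ p * shape Φ n E₂ E₁ p = 0 ∧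
    dd (shape Φ n E₂ E₂) p (E₁ p) + connCoeff Φ E₁ E₂ p * shape Φ n E₂ E₁ p -
      dd (shape Φ n E₁ E₂) p (E₂ p) + connCoeff Φ E₂ E₁ p * shape Φ n E₁ E₁ p +
      connCoeff Φ E₁ E₂ p * shape Φ n E₁ E₂ p - connCoeff Φ E₂ E₁ p * shape Φ n E₂ E₂ p = 0 := by
  -- The two equations are the tangential components of the commutator identity for `n`, whose first
  -- derivatives are tangent by parallelism.
  have h1 := h.commutator h.smooth_normal p
  rw [h.dd_dd_normal h.smooth_fst, h.dd_dd_normal h.smooth_snd, h.dd_normal (X := E₁),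
    h.dd_normal (X := E₂)] at h1
  obtain ⟨t1, t2, t3, t4⟩ := h.mink_connection p
  have hX := congrArg (fun z => mink z (push Φ E₁ p)) h1
  have hY := congrArg (fun z => mink z (push Φ E₂ p)) h1
  simp only [mink_add_left, mink_sub_left, mink_smul_left, h.mink_fst_fst, h.mink_fst_snd,
    h.mink_snd_fst, h.mink_snd_snd, t1, t2, t3, t4, h.mink_dd_fst_fst, h.mink_dd_snd_snd] at hX hY
  constructor <;> linarith

lemma dd_fun_eq (h : HasParallelMeanCurv Φ E₁ E₂ f n) (p : M) (x : TS p) :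
    dd (shape Φ n E₁ E₁) p x + dd (shape Φ n E₂ E₂) p x = -2 * dd f p x := by
  have h1 : (fun q => shape Φ n E₁ E₁ q + shape Φ n E₂ E₂ q) = fun q => (-2 : ℝ) • f q :=
    funext fun q => h.shape_trace q
  have h2 : dd (fun q => shape Φ n E₁ E₁ q + shape Φ n E₂ E₂ q) p x =
      dd (fun q => (-2 : ℝ) • f q) p x := by rw [h1]
  rw [dd_add ((h.smooth_shape h.smooth_fst h.smooth_fst).mdiff p)
    ((h.smooth_shape h.smooth_snd h.smooth_snd).mdiff p),
    dd_smul ((smoothMap_const (-2 : ℝ)).mdiff p) (h.smooth_fun.mdiff p), dd_const] at h2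
  simpa using h2

lemma tension_eq (h : HasParallelMeanCurv Φ E₁ E₂ f n) :
    tension Φ = fun p => (2 * f p) • n p := by
  funext p
  rw [tension, h.meanCurv_eq_smul, smul_smul]

lemma smooth_two_mul (h : HasParallelMeanCurv Φ E₁ E₂ f n) : SmoothMap fun p => 2 * f p :=
  (smoothMap_const (2 : ℝ)).fun_smul h.smooth_fun

lemma dd_two_mul (h : HasParallelMeanCurv Φ E₁ E₂ f n) (p : M) (x : TS p) :
    dd (fun q => 2 * f q) p x = 2 * dd f p x := by
  rw [dd_mul ((smoothMap_const (2 : ℝ)).mdiff p) (h.smooth_fun.mdiff p), dd_const]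
  ring

/-- Tangential components of the second derivatives of the tension field. -/
lemma mink_dd_dd_tension (h : HasParallelMeanCurv Φ E₁ E₂ f n) {X Y : (p : M) → TS p}
    (hX : SmoothField X) (hY : ∀ p, mink (n p) (push Φ Y p) = 0) (p : M) :
    mink (dd (fun q => dd (tension Φ) q (X q)) p (X p)) (push Φ Y p) =
      4 * dd f p (X p) * shape Φ n X Y p +
        2 * f p * mink (dd (fun q => dd n q (X q)) p (X p)) (push Φ Y p) := by
  have h1 : (fun q => dd (tension Φ) q (X q)) = fun q =>
      dd (fun q' => 2 * f q') q (X q) • n q + (2 * f q) • dd n q (X q) := by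
    funext q
    rw [h.tension_eq, dd_smul (h.smooth_two_mul.mdiff q) (h.smooth_normal.mdiff q)]
  rw [h1, dd_smul_add_smul (hX.smooth_dd h.smooth_two_mul) h.smooth_two_mul h.smooth_normal
    (hX.smooth_dd h.smooth_normal)]
  simp only [mink_add_left, mink_smul_left, hY, h.dd_two_mul]
  change _ + 2 * dd f p (X p) * shape Φ n X Y p +
    (2 * dd f p (X p) * shape Φ n X Y p + _) = _
  ring

lemma mink_dd_tension (h : HasParallelMeanCurv Φ E₁ E₂ f n) {X Y : (p : M) → TS p}
    (hY : ∀ p, mink (n p) (push Φ Y p) = 0) (p : M) :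
    mink (dd (tension Φ) p (X p)) (push Φ Y p) = 2 * f p * shape Φ n X Y p := by
  rw [h.tension_eq, dd_smul (h.smooth_two_mul.mdiff p) (h.smooth_normal.mdiff p), mink_add_left,
    mink_smul_left, mink_smul_left, hY, mul_zero, zero_add]
  rfl

/-- The biconservative equation `A (grad f) = - f grad f`, where `A` is the shape operator in the
direction of the mean curvature vector field (`d n = - A`). -/
lemma shape_grad (h : HasParallelMeanCurv Φ E₁ E₂ f n) (p : M)
    (hb : tan Φ p (bitension Φ p) = 0) :
    dd f p (E₁ p) * shape Φ n E₁ E₁ p + dd f p (E₂ p) * shape Φ n E₂ E₁ p =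
      f p * dd f p (E₁ p) ∧
    dd f p (E₁ p) * shape Φ n E₁ E₂ p + dd f p (E₂ p) * shape Φ n E₂ E₂ p =
      f p * dd f p (E₂ p) := by
  have hs : SmoothMap (tension Φ) := by
    rw [h.tension_eq]; exact h.smooth_two_mul.fun_smul h.smooth_normal
  have ht : ∀ p, mink (tension Φ p) (Φ p) = 0 := fun p => by
    rw [h.tension_eq, mink_smul_left, h.normal_self, mul_zero]
  have hn : ∀ p x, mink (tension Φ p) (dd Φ p x) = 0 := fun p x => by
    rw [h.tension_eq, mink_smul_left, (h.basis p).expand x, dd_add_right, dd_smul_right,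
      dd_smul_right, mink_add_right, mink_smul_right, mink_smul_right]
    change _ * (_ * mink (n p) (push Φ E₁ p) + _ * mink (n p) (push Φ E₂ p)) = 0
    rw [h.normal_fst, h.normal_snd]
    ring
  rw [h.tan_bitension hs ht hn, h.tan_accel_fst, h.tan_accel_snd] at hb
  obtain ⟨h1, h2⟩ := (h.basis p).mink_eq_zero_of_tan_eq_zero hb
  change mink _ (push Φ E₁ p) = 0 at h1
  change mink _ (push Φ E₂ p) = 0 at h2
  obtain ⟨t1, t2, t3, t4⟩ := h.mink_connection p
  have hfst := h.normal_fst
  have hsnd := h.normal_snd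
  simp only [mink_add_left, mink_sub_left, dd_smul_right, mink_smul_left,
    h.mink_dd_dd_tension h.smooth_fst hfst, h.mink_dd_dd_tension h.smooth_fst hsnd,
    h.mink_dd_dd_tension h.smooth_snd hfst, h.mink_dd_dd_tension h.smooth_snd hsnd,
    h.mink_dd_tension hfst, h.mink_dd_tension hsnd, h.dd_dd_normal h.smooth_fst,
    h.dd_dd_normal h.smooth_snd, h.mink_fst_fst, h.mink_fst_snd,
    h.mink_snd_fst, h.mink_snd_snd, t1, t2, t3, t4, h.mink_dd_fst_fst, h.mink_dd_snd_snd] at h1 h2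
  obtain ⟨c1, c2⟩ := h.codazzi p
  have d1 := h.dd_fun_eq p (E₁ p)
  have d2 := h.dd_fun_eq p (E₂ p)
  have hsymm : shape Φ n E₂ E₁ = shape Φ n E₁ E₂ := funext fun q => (h.shape_symm q).symm
  rw [hsymm] at h1 h2 c1 c2 ⊢
  constructor
  -- The tangential part for τ = 2f n is 4 dn(grad f) + 2f div(dn). Codazzi identifies div(dn) with
  -- d(trace dn) = -2 df, leaving 4 dn(grad f) - 4f grad f; hence the division by 4.
  · linear_combination h1 / 4 - f p / 2 * d1 + f p / 2 * c2
  · linear_combination h2 / 4 - f p / 2 * d2 - f p / 2 * c1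

end HasParallelMeanCurv
end Structure

/-! ### The principal frame and constancy of ξ -/

section Null

variable {M : Type*} [TopologicalSpace M] [ChartedSpace (EuclideanSpace ℝ (Fin 2)) M]
  [IsManifold (𝓡 2) ∞ M] {Φ : M → R51} {E₁ E₂ : (p : M) → TS p}

/-- A surface with parallel normalized mean curvature vector field whose frame is principal for
the mean curvature direction, with principal curvatures `-f` and `3 f`. -/
structure HasPrincipalFrame (Φ : M → R51) (E₁ E₂ : (p : M) → TS p) (f : M → ℝ) (n : M → R51) :
    Prop extends HasParallelMeanCurv Φ E₁ E₂ f n where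
  fun_pos : ∀ p, 0 < f p
  dd_fun_snd : ∀ p, dd f p (E₂ p) = 0
  dd_normal_fst : ∀ p, dd n p (E₁ p) = f p • push Φ E₁ p
  dd_normal_snd : ∀ p, dd n p (E₂ p) = (-3 * f p) • push Φ E₂ p

variable {f : M → ℝ} {n : M → R51}

/-- As E₂f = 0, cancelling E₁f ≠ 0 in `shape_grad` gives the E₁ row of dn; the trace -2f then forces
the eigenvalue -3f on E₂. -/
lemma HasParallelMeanCurv.hasPrincipalFrame (h : HasParallelMeanCurv Φ E₁ E₂ f n)
    (hf : ∀ p, 0 < f p) (h1 : ∀ p, dd f p (E₁ p) ≠ 0) (h2 : ∀ p, dd f p (E₂ p) = 0)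
    (hb : ∀ p, tan Φ p (bitension Φ p) = 0) : HasPrincipalFrame Φ E₁ E₂ f n := by
  have a11 (p : M) : shape Φ n E₁ E₁ p = f p := by
    have := (h.shape_grad p (hb p)).1
    rw [h2, zero_mul, add_zero, mul_comm (f p)] at this
    exact mul_left_cancel₀ (h1 p) this
  have a12 (p : M) : shape Φ n E₁ E₂ p = 0 := by
    have := (h.shape_grad p (hb p)).2
    rw [h2, zero_mul, add_zero, mul_zero] at this
    exact (mul_eq_zero.1 this).resolve_left (h1 p)
  have a22 (p : M) : shape Φ n E₂ E₂ p = -3 * f p := by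
    have := h.shape_trace p
    rw [a11] at this
    linarith
  refine ⟨h, hf, h2, fun p => ?_, fun p => ?_⟩
  · rw [h.dd_normal, a11, a12]
    module
  · rw [h.dd_normal, ← h.shape_symm, a12, a22]
    module

namespace HasPrincipalFrame

lemma dd_snd_fst (h : HasPrincipalFrame Φ E₁ E₂ f n) (p : M) :
    dd (push Φ E₂) p (E₁ p) = 0 ∧
      4 * f p * connCoeff Φ E₂ E₁ p = 3 * dd f p (E₁ p) := by
  have h1 := h.commutator h.smooth_normal p
  have h2 := h.commutator h.smooth p
  change dd (push Φ E₂) p (E₁ p) - dd (push Φ E₁) p (E₂ p) =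
    _ • push Φ E₁ p + _ • push Φ E₂ p at h2
  have hc : SmoothMap fun q => -3 * f q := (smoothMap_const (-3 : ℝ)).fun_smul h.smooth_fun
  have hd : dd (fun q => -3 * f q) p (E₁ p) = -3 * dd f p (E₁ p) := by
    rw [dd_mul ((smoothMap_const (-3 : ℝ)).mdiff p) (h.smooth_fun.mdiff p), dd_const]
    ring
  rw [funext h.dd_normal_fst, funext h.dd_normal_snd, h.dd_normal_fst, h.dd_normal_snd,
    dd_smul (hc.mdiff p) (h.smooth_push_snd.mdiff p),
    dd_smul (h.smooth_fun.mdiff p) (h.smooth_push_fst.mdiff p), hd, h.dd_fun_snd] at h1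
  -- This combination of the commutators on `n` and Φ eliminates ∇̂_{E₂}E₁ and the E₁ terms. The
  -- left side is orthogonal to E₂ and the right side is parallel to it, so both vanish.
  have h3 : (4 * f p) • dd (push Φ E₂) p (E₁ p) =
      (4 * f p * connCoeff Φ E₂ E₁ p - 3 * dd f p (E₁ p)) • push Φ E₂ p := by
    linear_combination (norm := module) (-1 : ℝ) • h1 + f p • h2
  have h4 := congrArg (fun z => mink z (push Φ E₂ p)) h3
  simp only [mink_smul_left, h.mink_snd_snd, h.mink_dd_snd_snd] at h4
  have h5 : 4 * f p * connCoeff Φ E₂ E₁ p - 3 * dd f p (E₁ p) = 0 := by linarith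
  rw [h5, zero_smul] at h3
  exact ⟨(smul_eq_zero.1 h3).resolve_left (by have := h.fun_pos p; positivity), by linarith⟩

lemma connCoeff_fst (h : HasPrincipalFrame Φ E₁ E₂ f n) (p : M) : connCoeff Φ E₁ E₂ p = 0 := by
  have h1 := (h.mink_connection p).2.1
  rw [(h.dd_snd_fst p).1, mink_zero_left] at h1
  linarith

lemma dd_fst_snd (h : HasPrincipalFrame Φ E₁ E₂ f n) (p : M) :
    dd (push Φ E₁) p (E₂ p) = -connCoeff Φ E₂ E₁ p • push Φ E₂ p := by
  have h2 := h.commutator h.smooth p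
  change dd (push Φ E₂) p (E₁ p) - dd (push Φ E₁) p (E₂ p) =
    _ • push Φ E₁ p + _ • push Φ E₂ p at h2
  rw [(h.dd_snd_fst p).1, h.connCoeff_fst, neg_zero, zero_smul, zero_add, zero_sub] at h2
  rw [neg_smul, ← h2, neg_neg]

/-- The commutator on `f` gives E₂E₁f = 0; now differentiate 4fω = 3E₁f along E₂. -/
lemma dd_connCoeff_snd (h : HasPrincipalFrame Φ E₁ E₂ f n) (p : M) :
    dd (connCoeff Φ E₂ E₁) p (E₂ p) = 0 := by
  have h1 := h.commutator h.smooth_fun p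
  rw [funext h.dd_fun_snd, dd_const, h.connCoeff_fst, h.dd_fun_snd] at h1
  have h2 : dd (fun q => dd f q (E₁ q)) p (E₂ p) = 0 := by simpa using h1
  have h3 : (fun q => f q * connCoeff Φ E₂ E₁ q) = fun q => (3 / 4 : ℝ) * dd f q (E₁ q) :=
    funext fun q => by linarith [(h.dd_snd_fst q).2]
  have h4 : dd (fun q => f q * connCoeff Φ E₂ E₁ q) p (E₂ p) =
      dd (fun q => (3 / 4 : ℝ) * dd f q (E₁ q)) p (E₂ p) := by rw [h3]
  rw [dd_mul (h.smooth_fun.mdiff p) (h.smooth_connCoeff_snd.mdiff p),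
    dd_mul ((smoothMap_const (3 / 4 : ℝ)).mdiff p)
      ((h.smooth_fst.smooth_dd h.smooth_fun).mdiff p), dd_const, h.dd_fun_snd, h2] at h4
  have h5 : f p * dd (connCoeff Φ E₂ E₁) p (E₂ p) = 0 := by linarith
  exact (mul_eq_zero.1 h5).resolve_left (h.fun_pos p).ne'

/-- `∇̂_{E₂} ∇̂_{E₁} E₁` is a multiple of `E₂`. -/
lemma dd_accel_fst (h : HasPrincipalFrame Φ E₁ E₂ f n) (p : M) :
    dd (accel Φ E₁) p (E₂ p) =
      (connCoeff Φ E₂ E₁ p ^ 2 - dd (connCoeff Φ E₂ E₁) p (E₁ p)) • push Φ E₂ p := by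
  -- Flatness exchanges the two derivatives of E₁, and ∇̂_{E₂}E₁ = -ωE₂ is already known.
  have h1 := h.commutator h.smooth_push_fst p
  change _ - dd (accel Φ E₁) p (E₂ p) = _ at h1
  rw [funext h.dd_fst_snd, dd_smul (h.smooth_connCoeff_snd.fun_neg.mdiff p)
    (h.smooth_push_snd.mdiff p), (h.dd_snd_fst p).1, h.connCoeff_fst, dd_neg, h.dd_fst_snd] at h1
  linear_combination (norm := module) (-1 : ℝ) • h1

/-- If `ξ = ∇̂_{E₂} E₂` is null, then it is constant along the integral curves of `E₂`. -/
lemma dd_accel_snd (h : HasPrincipalFrame Φ E₁ E₂ f n)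
    (hnull : ∀ p, mink (accel Φ E₂ p) (accel Φ E₂ p) = 0) (p : M) :
    dd (accel Φ E₂) p (E₂ p) = 0 := by
  have hs1 : SmoothMap (accel Φ E₁) := h.smooth_fst.smooth_dd h.smooth_push_fst
  have hs2 : SmoothMap (accel Φ E₂) := h.smooth_snd.smooth_dd h.smooth_push_snd
  have h1 : accel Φ E₂ = fun q => ((2 * f q) • n q + (2 : ℝ) • Φ q) +
      (connCoeff Φ E₂ E₁ q • push Φ E₁ q + (-1 : ℝ) • accel Φ E₁ q) := by
    funext q
    have := h.accel_add_accel q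
    rw [h.connCoeff_fst, zero_smul, add_zero] at this
    linear_combination (norm := module) this
  have hc (c : ℝ) : SmoothMap fun _ : M => c := smoothMap_const c
  -- The coefficients 2f and ω are constant along E₂, while the E₂-derivatives of n, Φ, E₁ and
  -- ∇̂_{E₁}E₁ are all multiples of E₂.
  have h2 : ∃ μ : ℝ, dd (accel Φ E₂) p (E₂ p) = μ • push Φ E₂ p := by
    rw [h1, dd_add, dd_smul_add_smul h.smooth_two_mul (hc 2) h.smooth_normal h.smooth,
      dd_smul_add_smul h.smooth_connCoeff_snd (hc (-1)) h.smooth_push_fst hs1, dd_const, dd_const,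
      h.dd_two_mul, h.dd_fun_snd, h.dd_connCoeff_snd, h.dd_normal_snd, h.dd_accel_fst,
      h.dd_fst_snd]
    · change ∃ μ : ℝ, (2 * (0 : ℝ)) • n p + _ + (_ + (2 : ℝ) • push Φ E₂ p) + _ = _
      refine ⟨2 * f p * (-3 * f p) + 2 - connCoeff Φ E₂ E₁ p * connCoeff Φ E₂ E₁ p -
        (connCoeff Φ E₂ E₁ p ^ 2 - dd (connCoeff Φ E₂ E₁) p (E₁ p)), ?_⟩
      module
    · exact ((h.smooth_two_mul.fun_smul h.smooth_normal).fun_add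
        ((hc 2).fun_smul h.smooth)).mdiff p
    · exact ((h.smooth_connCoeff_snd.fun_smul h.smooth_push_fst).fun_add
        ((hc (-1)).fun_smul hs1)).mdiff p
  obtain ⟨μ, hμ⟩ := h2
  -- Differentiating ⟨ξ, E₂⟩ = 0 along E₂ gives μ + ⟨ξ, ξ⟩ = 0: this is where nullity enters.
  have h3 := mink_dd_add_mink_dd hs2 h.smooth_push_snd
    (fun q => h.mink_dd_snd_snd q (E₂ q)) p (E₂ p)
  change _ + mink (accel Φ E₂ p) (accel Φ E₂ p) = 0 at h3
  rw [hnull, hμ, mink_smul_left, h.mink_snd_snd] at h3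
  have h4 : μ = 0 := by linarith
  rw [hμ, h4, zero_smul]

end HasPrincipalFrame

/-- A PNMC biconservative surface with its adapted frame is framed. -/
lemma IsAdaptedFrame.isFramed (hE : IsAdaptedFrame Φ E₁ E₂) (hΦ : IsPNMCBiconservative Φ) :
    IsFramed Φ E₁ E₂ := by
  refine ⟨hΦ.smooth, hΦ.mem_hyperboloid, hE.smooth_fst, hE.smooth_snd,
    fun p => ⟨?_, hE.orthogonal p, hE.unit_snd p⟩⟩
  set G := grad Φ (meanFun Φ) p with hG
  have ht := mink_dd_self_of_mem_hyperboloid hΦ.smooth hΦ.mem_hyperboloid p G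
  have h0 : dd Φ p G ≠ 0 := by
    intro h0
    rw [← dd_zero_right Φ p] at h0
    exact hΦ.grad_ne_zero p (hΦ.immersion p h0)
  -- Vectors tangent to ℍ⁴ are spacelike, so the induced metric is positive on the nonzero gradient
  -- and normalizing by the square root gives a unit vector.
  have hpos : 0 < met Φ p G G := lt_of_le_of_ne (mink_self_nonneg (hΦ.mem_hyperboloid p) ht)
    fun h => h0 (eq_zero_of_mink_self_eq_zero (hΦ.mem_hyperboloid p) ht h.symm)
  have hsq := Real.mul_self_sqrt hpos.le
  have hs := Real.sqrt_pos.2 hpos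
  rw [hE.fst_eq]
  simp only [← hG]
  set s := Real.sqrt (met Φ p G G) with hsdef
  rw [met, dd_smul_right, mink_smul_left, mink_smul_right]
  change 1 / s * (1 / s * met Φ p G G) = 1
  rw [← hsq]
  field_simp

lemma mink_smul_self_eq_one {w : R51} (hw : 0 < Real.sqrt (mink w w)) :
    mink ((1 / Real.sqrt (mink w w)) • w) ((1 / Real.sqrt (mink w w)) • w) = 1 := by
  have hsq := Real.mul_self_sqrt (Real.sqrt_pos.1 hw).le
  rw [mink_smul_left, mink_smul_right]
  nth_rewrite 3 [← hsq]
  field_simp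

lemma IsFramed.smooth_meanCurv (h : IsFramed Φ E₁ E₂) : SmoothMap (meanCurv Φ) := by
  rw [funext h.meanCurv_eq]
  simp only [h.nor_projH]
  have hS : SmoothMap fun q => dd (push Φ E₁) q (E₁ q) + dd (push Φ E₂) q (E₂ q) :=
    (h.smooth_fst.smooth_dd h.smooth_push_fst).fun_add (h.smooth_snd.smooth_dd h.smooth_push_snd)
  exact (smoothMap_const (1 / 2 : ℝ)).fun_smul
    ((hS.fun_add ((hS.mink h.smooth).fun_smul h.smooth)).fun_sub
      (((hS.mink h.smooth_push_fst).fun_smul h.smooth_push_fst).fun_add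
        ((hS.mink h.smooth_push_snd).fun_smul h.smooth_push_snd)))

lemma IsFramed.smooth_meanFun (h : IsFramed Φ E₁ E₂) (hf : ∀ p, 0 < meanFun Φ p) :
    SmoothMap (meanFun Φ) := fun p =>
  ContDiffAt.comp_contMDiffAt (Real.contDiffAt_sqrt (Real.sqrt_pos.1 (hf p)).ne')
    (h.smooth_meanCurv.mink h.smooth_meanCurv p)

/-- `H` is normal to the surface and tangent to the hyperboloid. -/
lemma IsFramed.mink_meanCurv (h : IsFramed Φ E₁ E₂) (p : M) :
    mink (meanCurv Φ p) (Φ p) = 0 ∧ mink (meanCurv Φ p) (push Φ E₁ p) = 0 ∧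
      mink (meanCurv Φ p) (push Φ E₂ p) = 0 := by
  have h1 : mink (push Φ E₁ p) (Φ p) = 0 := h.mink_dd_self p (E₁ p)
  have h2 : mink (push Φ E₂ p) (Φ p) = 0 := h.mink_dd_self p (E₂ p)
  have h1' : mink (Φ p) (push Φ E₁ p) = 0 := by rw [mink_comm, h1]
  have h2' : mink (Φ p) (push Φ E₂ p) = 0 := by rw [mink_comm, h2]
  have hq := (h.mem_hyperboloid p).1
  simp only [h.meanCurv_eq, h.nor_projH, mink_smul_left, mink_add_left, mink_sub_left, h1, h2,
    h1', h2', hq, h.mink_fst_fst, h.mink_fst_snd, h.mink_snd_fst, h.mink_snd_snd]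
  refine ⟨?_, ?_, ?_⟩ <;> ring

lemma IsAdaptedFrame.hasPrincipalFrame (hE : IsAdaptedFrame Φ E₁ E₂)
    (hΦ : IsPNMCBiconservative Φ) :
    HasPrincipalFrame Φ E₁ E₂ (meanFun Φ) fun p => (1 / meanFun Φ p) • meanCurv Φ p := by
  have h := hE.isFramed hΦ
  have hf := h.smooth_meanFun hΦ.meanFun_pos
  have hinv : SmoothMap fun p => 1 / meanFun Φ p := fun p =>
    ContDiffAt.comp_contMDiffAt (f := meanFun Φ) (g := fun x : ℝ => 1 / x)
      (contDiffAt_const.div contDiffAt_id (hΦ.meanFun_pos p).ne') (hf p)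
  have hp : HasParallelMeanCurv Φ E₁ E₂ (meanFun Φ)
      fun p => (1 / meanFun Φ p) • meanCurv Φ p := by
    refine ⟨h, hf, hinv.fun_smul h.smooth_meanCurv,
      fun p => mink_smul_self_eq_one (hΦ.meanFun_pos p), fun p => ?_, fun p => ?_, fun p => ?_,
      fun p x => hΦ.parallel p x, fun p => ?_⟩
    · rw [mink_smul_left, (h.mink_meanCurv p).1, mul_zero]
    · rw [mink_smul_left, (h.mink_meanCurv p).2.1, mul_zero]
    · rw [mink_smul_left, (h.mink_meanCurv p).2.2, mul_zero]
    · rw [smul_smul, mul_one_div_cancel (hΦ.meanFun_pos p).ne', one_smul]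
  have hg (p : M) (x : TS p) : met Φ p (grad Φ (meanFun Φ) p) x = dd (meanFun Φ) p x := by
    conv_rhs => rw [(h.basis p).expand x]
    rw [(h.basis p).grad_eq, met, dd_add_right, dd_smul_right, dd_smul_right, mink_add_left,
      mink_smul_left, mink_smul_left, dd_add_right, dd_smul_right, dd_smul_right]
    change _ * met Φ p (E₁ p) x + _ * met Φ p (E₂ p) x = _
    rw [smul_eq_mul, smul_eq_mul, met, met, met, met, mink_comm (dd Φ p x),
      mink_comm (dd Φ p x)]
    ring
  have h2 (p : M) : dd (meanFun Φ) p (E₂ p) = 0 := by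
    have h3 := hE.orthogonal p
    rw [hE.fst_eq, met, dd_smul_right, mink_smul_left] at h3
    change _ * met Φ p (grad Φ (meanFun Φ) p) (E₂ p) = 0 at h3
    rw [hg p (E₂ p)] at h3
    -- If the normalizing factor vanished, E₁ would be zero instead of a unit vector.
    refine (mul_eq_zero.1 h3).resolve_left fun h0 => ?_
    have h4 := (h.basis p).fst
    rw [hE.fst_eq, h0, zero_smul, met, dd_zero_right, mink_zero_left] at h4
    exact zero_ne_one h4
  refine hp.hasPrincipalFrame hΦ.meanFun_pos (fun p h1 => hΦ.grad_ne_zero p ?_) h2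
    hΦ.biconservative
  rw [(h.basis p).grad_eq, h1, h2, zero_smul, zero_smul, add_zero]

end Null

/-! ### Integral curves and constant acceleration -/

section Curve

variable {M : Type*} [TopologicalSpace M] [ChartedSpace (EuclideanSpace ℝ (Fin 2)) M]

lemma hasDerivAt_comp_integralCurve {E : Type*} [NormedAddCommGroup E] [NormedSpace ℝ E]
    {F : M → E} (hF : SmoothMap F) {X : (p : M) → TS p} {γ : ℝ → M} {J : Set ℝ} (hJ : IsOpen J)
    (hγ : IsMIntegralCurveOn (I := 𝓡 2) γ X J) {v : ℝ} (hv : v ∈ J) :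
    HasDerivAt (fun t => F (γ t)) (dd F (γ v) (X (γ v))) v := by
  have h1 := (hγ v hv).hasMFDerivAt (hJ.mem_nhds hv)
  have h2 : HasFDerivAt (F ∘ γ) ((1 : ℝ →L[ℝ] ℝ).smulRight (dd F (γ v) (X (γ v)))) v :=
    (HasMFDerivAt.comp v (hF.mdiff (γ v)).hasMFDerivAt h1).hasFDerivAt.congr_fderiv
      (by ext; exact dd_smul_right F (γ v) 1 (X (γ v)))
  have h3 := h2.hasDerivAt
  rwa [ContinuousLinearMap.smulRight_apply, one_apply_eq_self, one_smul] at h3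

/-- A function with vanishing derivative on an open interval is constant. -/
lemma eq_of_hasDerivAt_zero {E : Type*} [NormedAddCommGroup E] [NormedSpace ℝ E] {c : ℝ → E} {J : Set ℝ} (hJo : IsOpen J) (hJ : J.OrdConnected)
    (hc : ∀ v ∈ J, HasDerivAt c 0 v) {u v : ℝ} (hu : u ∈ J) (hv : v ∈ J) : c u = c v :=
  hJo.is_const_of_deriv_eq_zero hJ.isPreconnected
    (fun t ht => (hc t ht).differentiableAt.differentiableWithinAt) (fun t ht => (hc t ht).deriv)
    hu hv

/-- Curves with constant acceleration. -/
lemma eq_of_constant_acceleration {E : Type*} [NormedAddCommGroup E] [NormedSpace ℝ E]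
    {c d : ℝ → E} {w : E} {J : Set ℝ} (hJo : IsOpen J)
    (hJ : J.OrdConnected) (h0 : (0 : ℝ) ∈ J) (hc : ∀ v ∈ J, HasDerivAt c (d v) v)
    (hd : ∀ v ∈ J, HasDerivAt d w v) {v : ℝ} (hv : v ∈ J) :
    c v = c 0 + v • d 0 + (v ^ 2 / 2) • w := by
  have h1 : ∀ u ∈ J, d u = d 0 + u • w := by
    intro u hu
    have h := eq_of_hasDerivAt_zero (c := fun t => d t - t • w) hJo hJ (fun t ht => by
      have h2 := (hd t ht).sub ((hasDerivAt_id t).smul_const w)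
      rwa [one_smul, sub_self] at h2) hu h0
    simp only [zero_smul, sub_zero] at h
    rw [← h, sub_add_cancel]
  have h := eq_of_hasDerivAt_zero (c := fun t => c t - (t • d 0 + (t ^ 2 / 2) • w)) hJo hJ
    (fun t ht => by
      have h2 := (hc t ht).sub (((hasDerivAt_id t).smul_const (d 0)).add
        ((((hasDerivAt_id t).pow 2).div_const 2).smul_const w))
      have h3 : d t - ((1 : ℝ) • d 0 + ((2 : ℕ) * id t ^ (2 - 1) * 1 / 2) • w) = 0 := by
        rw [h1 t ht]
        simp
      rwa [h3] at h2) hv h0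
  simp only [zero_smul] at h
  rw [sub_eq_iff_eq_add] at h
  rw [h]
  simp [add_assoc]

end Curve

/-! ### Parabolas and lightlike planes -/

section Parabola

variable {B₀ B₁ B₂ : R51}

/-- Pairing a relation with B₁ isolates its first coefficient; B₂ ≠ 0 disposes of the second. -/
lemma linearIndependent_of_null (h11 : mink B₁ B₁ = 1) (h12 : mink B₁ B₂ = 0) (h2 : B₂ ≠ 0) :
    LinearIndependent ℝ ![B₁, B₂] := by
  rw [LinearIndependent.pair_iff]
  intro s t hst
  have hs : s = 0 := by
    have := congrArg (mink B₁) hst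
    simpa [mink_add_right, mink_smul_right, mink_zero_right, h11, h12] using this
  rw [hs, zero_smul, zero_add] at hst
  exact ⟨hs, (smul_eq_zero.1 hst).resolve_right h2⟩

lemma isParabola_range (h : LinearIndependent ℝ ![B₁, B₂]) :
    IsParabola (Set.range fun v : ℝ => B₀ + v • B₁ + (v ^ 2 / 2) • B₂) := by
  -- The factor 1/2 on B₂ makes the model curve be exactly y = x².
  let L : (ℝ × ℝ) →ₗ[ℝ] R51 := (LinearMap.fst ℝ ℝ ℝ).smulRight B₁ +
    (LinearMap.snd ℝ ℝ ℝ).smulRight ((1 / 2 : ℝ) • B₂)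
  have hL (z : ℝ × ℝ) : L z = z.1 • B₁ + z.2 • (1 / 2 : ℝ) • B₂ := rfl
  refine ⟨L.toAffineMap + AffineMap.const ℝ _ B₀, fun z z' hz => ?_, ?_⟩
  · have h1 : L z + B₀ = L z' + B₀ := hz
    have h2 : (z.1 - z'.1) • B₁ + ((z.2 - z'.2) / 2) • B₂ = 0 := by
      have h3 := add_right_cancel h1
      rw [hL, hL] at h3
      linear_combination (norm := module) h3
    obtain ⟨h3, h4⟩ := LinearIndependent.pair_iff.1 h _ _ h2
    exact Prod.ext (by linarith) (by linarith)
  · ext w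
    constructor
    · rintro ⟨v, rfl⟩
      refine ⟨(v, v ^ 2), rfl, ?_⟩
      change L (v, v ^ 2) + B₀ = _
      rw [hL]
      module
    · rintro ⟨⟨a, b⟩, hz, rfl⟩
      refine ⟨a, ?_⟩
      change _ = L (a, b) + B₀
      have hz' : b = a ^ 2 := hz
      rw [hL, hz']
      module

lemma isLightlikePlane_mk' (h : LinearIndependent ℝ ![B₁, B₂]) (h22 : mink B₂ B₂ = 0)
    (h12 : mink B₁ B₂ = 0) :
    IsLightlikePlane (AffineSubspace.mk' B₀ (Submodule.span ℝ {B₁, B₂})) := by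
  refine ⟨⟨B₀, AffineSubspace.self_mem_mk' _ _⟩, ?_, B₂, ?_, ?_, ?_⟩
  · rw [AffineSubspace.direction_mk']
    have := finrank_span_eq_card h
    rwa [Matrix.range_cons, Matrix.range_cons, Matrix.range_empty, Set.union_empty,
      Set.singleton_union, Fintype.card_fin] at this
  · rw [AffineSubspace.direction_mk']
    exact Submodule.subset_span (by simp)
  · simpa using h.ne_zero 1
  · intro u hu
    rw [AffineSubspace.direction_mk', Submodule.mem_span_pair] at hu
    obtain ⟨a, b, rfl⟩ := hu
    rw [mink_add_right, mink_smul_right, mink_smul_right, h22, mink_comm, h12]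
    ring

lemma mem_mk'_span_pair (a b : ℝ) :
    B₀ + a • B₁ + b • B₂ ∈ AffineSubspace.mk' B₀ (Submodule.span ℝ {B₁, B₂}) := by
  rw [AffineSubspace.mem_mk', vsub_eq_sub, Submodule.mem_span_pair]
  exact ⟨a, b, by module⟩

end Parabola
end PNMC
end

/-! ### The integral curve of E₂ -/

theorem mainTheorem5 {M : Type*} [TopologicalSpace M] [T2Space M] [SecondCountableTopology M]
    [ConnectedSpace M] [ChartedSpace (EuclideanSpace ℝ (Fin 2)) M] [IsManifold (𝓡 2) ∞ M]
    (Φ : M → PNMC.R51) (hΦ : PNMC.IsPNMCBiconservative Φ)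
    (E₁ E₂ : (p : M) → TangentSpace (𝓡 2) p) (hE : PNMC.IsAdaptedFrame Φ E₁ E₂)
    -- `ξ = ∇̂_{E₂} E₂` is a nonzero null vector field
    (ξ : M → PNMC.R51) (hξ : ξ = PNMC.accel Φ E₂)
    (hne : ∀ p, ξ p ≠ 0) (hnull : ∀ p, PNMC.mink (ξ p) (ξ p) = 0)
    -- `γ` is an integral curve of `E₂` on an open interval `J` that contains `0`
    (J : Set ℝ) (hJo : IsOpen J) (hJ : J.OrdConnected) (h0 : (0 : ℝ) ∈ J)
    (γ : ℝ → M) (hγ : IsMIntegralCurveOn (I := 𝓡 2) γ E₂ J) :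
    -- `Φ ∘ γ` is a smooth unit speed curve with acceleration `ξ`, and its curvature is zero
    (ContDiffOn ℝ ∞ (Φ ∘ γ) J ∧
      ∀ v ∈ J, PNMC.mink (deriv (Φ ∘ γ) v) (deriv (Φ ∘ γ) v) = 1 ∧
        deriv (deriv (Φ ∘ γ)) v = ξ (γ v) ∧ PNMC.curveCurvature (Φ ∘ γ) v = 0) ∧
    -- `ξ` is constant along the curve
    (∀ v ∈ J, ξ (γ v) = ξ (γ 0)) ∧
    -- the curve is a parabola in a lightlike affine plane
    ∃ B₀ B₁ B₂ : PNMC.R51,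
      B₀ = Φ (γ 0) ∧ B₁ = PNMC.push Φ E₂ (γ 0) ∧ B₂ = ξ (γ 0) ∧
      (∀ v ∈ J, Φ (γ v) = B₀ + v • B₁ + (v ^ 2 / 2) • B₂) ∧
      PNMC.mink B₁ B₁ = 1 ∧ PNMC.mink B₂ B₂ = 0 ∧ PNMC.mink B₁ B₂ = 0 ∧
      PNMC.IsParabola (Set.range fun v : ℝ => B₀ + v • B₁ + (v ^ 2 / 2) • B₂) ∧
      PNMC.IsLightlikePlane (AffineSubspace.mk' B₀ (Submodule.span ℝ {B₁, B₂})) ∧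
      (∀ v ∈ J, Φ (γ v) ∈ AffineSubspace.mk' B₀ (Submodule.span ℝ {B₁, B₂})) := by

  have h := hE.hasPrincipalFrame hΦ
  subst hξ
  have hsξ : PNMC.SmoothMap (PNMC.accel Φ E₂) := h.smooth_snd.smooth_dd h.smooth_push_snd
  have hc : ∀ v ∈ J, HasDerivAt (Φ ∘ γ) (PNMC.push Φ E₂ (γ v)) v := fun v hv =>
    PNMC.hasDerivAt_comp_integralCurve h.smooth hJo hγ hv
  have hd : ∀ v ∈ J, HasDerivAt (fun t => PNMC.push Φ E₂ (γ t)) (PNMC.accel Φ E₂ (γ v)) v :=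
    fun v hv => PNMC.hasDerivAt_comp_integralCurve h.smooth_push_snd hJo hγ hv
  have hξ0 : ∀ v ∈ J, HasDerivAt (fun t => PNMC.accel Φ E₂ (γ t)) 0 v := fun v hv => by
    have h1 := PNMC.hasDerivAt_comp_integralCurve hsξ hJo hγ hv
    rwa [h.dd_accel_snd hnull] at h1
  have hconst : ∀ v ∈ J, PNMC.accel Φ E₂ (γ v) = PNMC.accel Φ E₂ (γ 0) := fun v hv =>
    PNMC.eq_of_hasDerivAt_zero hJo hJ hξ0 hv h0
  have hpar : ∀ v ∈ J, Φ (γ v) = Φ (γ 0) + v • PNMC.push Φ E₂ (γ 0) +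
      (v ^ 2 / 2) • PNMC.accel Φ E₂ (γ 0) := fun v hv =>
    PNMC.eq_of_constant_acceleration hJo hJ h0 hc
      (fun u hu => by rw [← hconst u hu]; exact hd u hu) hv
  have hdd : ∀ v ∈ J, deriv (deriv (Φ ∘ γ)) v = PNMC.accel Φ E₂ (γ v) := fun v hv => by
    have h1 : deriv (Φ ∘ γ) =ᶠ[nhds v] fun t => PNMC.push Φ E₂ (γ t) := by
      filter_upwards [hJo.mem_nhds hv] with t ht
      exact (hc t ht).deriv
    rw [h1.deriv_eq, (hd v hv).deriv]
  have h11 := h.mink_snd_snd (γ 0)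
  have h12 : PNMC.mink (PNMC.push Φ E₂ (γ 0)) (PNMC.accel Φ E₂ (γ 0)) = 0 := by
    rw [PNMC.mink_comm]; exact h.mink_dd_snd_snd (γ 0) (E₂ (γ 0))
  have hli := PNMC.linearIndependent_of_null h11 h12 (hne (γ 0))
  refine ⟨⟨?_, fun v hv => ⟨?_, hdd v hv, ?_⟩⟩, hconst, _, _, _, rfl, rfl, rfl, hpar, h11,
    hnull _, h12, PNMC.isParabola_range hli, PNMC.isLightlikePlane_mk' hli (hnull _) h12,
    fun v hv => ?_⟩
  -- Smoothness is read off the quadratic formula, so no regularity of γ beyond differentiability is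
  -- needed.
  · refine ContDiffOn.congr (f := fun v : ℝ => Φ (γ 0) + v • PNMC.push Φ E₂ (γ 0) +
      (v ^ 2 / 2) • PNMC.accel Φ E₂ (γ 0)) ?_ hpar
    fun_prop
  · rw [(hc v hv).deriv]
    exact h.mink_snd_snd (γ v)
  · rw [PNMC.curveCurvature, hdd v hv, hnull, abs_zero, Real.sqrt_zero]
  · rw [hpar v hv]
    exact PNMC.mem_mk'_span_pair v (v ^ 2 / 2)
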